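/- Let $X$ be a complex Banach space, let $L(X)$ be the algebra of bounded linear operators on $X$, and let $T\in L(X)$. Let $\sigma_*$ denote any one of the spectrum $\sigma$, the Browder spectrum $\sigma_b$ or the Drazin spectrum $\sigma_d$, where $\sigma_b(T)$ (respectively $\sigma_d(T)$) is the set of $z\in\mathbb C$ such that $T-zI$ is not a Fredholm operator with finite ascent and finite descent (respectively not an operator with finite ascent and finite descent). For $A\subset\mathbb C$ let $\mathrm{acc}\,A$ be the set of its accumulation points and $\mathrm{iso}\,A=A\setminus\mathrm{acc}\,A$. For closed $A$ and an ordinal $\alpha$, let $\mathrm{acc}^{\alpha}A$ be the $\alpha$-th Cantor-Bendixson derivative: $\mathrm{acc}^0A=A$, $\mathrm{acc}^{\alpha+1}A=\mathrm{acc}(\mathrm{acc}^{\alpha}A)$, and $\mathrm{acc}^{\alpha}A=\bigcap_{\beta<\alpha}\mathrm{acc}^{\beta}A$ for a limit ordinal $\alpha$. Let $\omega_1$ be the first uncountable ordinal. Write $\mathrm{comm}(T)=\{S\in L(X):ST=TS\}$ and $\mathrm{comm}^2(T)=\{S\in L(X): SR=RS \text{ for all } R\in\mathrm{comm}(T)\}$.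 For a $T$-invariant subspace $M$, let $T_M$ be the restriction of $T$ to $M$. Write $(M,N)\in\mathrm{Red}(T)$ if $M,N$ are closed $T$-invariant subspaces with $X=M\oplus N$, and $(M,N)\in\mathrm{Red}^2(T)$ if $(M,N)\in\mathrm{Red}(S)$ for every $S\in\mathrm{comm}(T)$. Let $\mathcal D_{al}(T)$ be the set of all $(M,N)\in\mathrm{Red}(T)$ such that $T_M$ is invertible and $\sigma(T_N)$ is at most countable; $T$ is almost invertible if $\mathcal D_{al}(T)\neq\emptyset$. For a successor ordinal $\alpha=\beta+1$, $T$ is $g^{\alpha}_{\sigma_*}$-invertible if there is $(M,N)\in\mathrm{Red}(T)$ with $T_M$ invertible and $\mathrm{acc}^{\beta}\sigma_*(T_N)\subset\{0\}$; for a limit ordinal $\alpha$, $T$ is $g^{\alpha}_{\sigma_*}$-invertible if it is $g^{\beta}_{\sigma_*}$-invertible for some successor ordinal $\beta<\alpha$. A spectral set of $T$ is a subset of $\sigma(T)$ that is clopen in $\sigma(T)$. Then the following statements are equivalent: (i) $T$ is almost invertible; (ii) $T$ is $g^{\omega_1}_{\sigma_*}$-invertible; (iii) $0\notin\mathrm{acc}^{\omega_1}\sigma_*(T)$;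 (iv) there exists $(M,N)\in\mathrm{Red}^2(T)\cap\mathcal D_{al}(T)$; (v) there exist $T$-invariant subspaces $M,N$ such that $N$ is closed, $X=M\oplus N$ (algebraically), $T_M:M\to M$ is bijective and $\sigma_*(T_N)$ is at most countable; (vi) there exists an at most countable spectral set $\tilde\sigma$ of $T$ such that $0\notin\sigma(T)\setminus\tilde\sigma$; (vii) there exists a spectral set $\tilde\sigma$ of $T$ such that $0\notin\sigma(T)\setminus\tilde\sigma$ and $\tilde\sigma\setminus\{0\}\subset\bigcup_{\beta<\omega_1}\mathrm{iso}(\mathrm{acc}^{\beta}\sigma(T))$; (viii) there exists a bounded projection $P\in\mathrm{comm}(T)$ such that $T+P$ is almost invertible and $\sigma_*(TP)$ is at most countable; (ix) there exists a bounded projection $P\in\mathrm{comm}^2(T)$ such that $T+P$ is almost invertible and $\sigma_*(TP)$ is at most countable; (x) there exists $S\in\mathrm{comm}(T)$ such that $S^2T=S$ and $\sigma_*(T-T^2S)$ is at most countable; (xi) there exists $S\in\mathrm{comm}^2(T)$ such that $S^2T=S$ and $\sigma_*(T-T^2S)$ is at most countable. -/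

import Mathlib

open scoped Ordinal

namespace AlmostInv

section Spectra

variable {X : Type*} [NormedAddCommGroup X] [NormedSpace ℂ X]

/-- Finite ascent: the chain of kernels `ker T ⊆ ker T² ⊆ …` becomes stationary. -/
def FiniteAscent (T : X →L[ℂ] X) : Prop :=
  ∃ p : ℕ, (T ^ p).ker = (T ^ (p + 1)).ker

/-- Finite descent: the chain of ranges `ran T ⊇ ran T² ⊇ …` becomes stationary. -/
def FiniteDescent (T : X →L[ℂ] X) : Prop :=
  ∃ q : ℕ, (T ^ q).range = (T ^ (q + 1)).range

/-- `T` is Drazin invertible if it has finite ascent and finite descent. -/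
def IsDrazinInvertible (T : X →L[ℂ] X) : Prop :=
  FiniteAscent T ∧ FiniteDescent T

/-- `T` is a Browder operator if it is Fredholm with finite ascent and finite descent. -/
def IsBrowder (T : X →L[ℂ] X) : Prop :=
  T.IsFredholm ∧ FiniteAscent T ∧ FiniteDescent T

/-- The Drazin spectrum `σ_d(T)`. -/
def drazinSpectrum (T : X →L[ℂ] X) : Set ℂ :=
  {z | ¬ IsDrazinInvertible (T - z • (1 : X →L[ℂ] X))}

/-- The Browder spectrum `σ_b(T)`. -/
def browderSpectrum (T : X →L[ℂ] X) : Set ℂ :=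
  {z | ¬ IsBrowder (T - z • (1 : X →L[ℂ] X))}

end Spectra

/-- The three possible choices for `σ_*`. -/
inductive SpectrumKind
  | usual
  | browder
  | drazin

section Operators

variable {X : Type*} [NormedAddCommGroup X] [NormedSpace ℂ X]

/-- `σ_*(T)`, where `σ_*` is one of `σ`, `σ_b`, `σ_d`. -/
def sigmaStar (k : SpectrumKind) (T : X →L[ℂ] X) : Set ℂ :=
  match k with
  | .usual => spectrum ℂ T
  | .browder => browderSpectrum T
  | .drazin => drazinSpectrum T

/-- The `α`-th Cantor-Bendixson derivative of `A`. At a successor step this takes the accumulation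
points of the previous stage that belong to that stage; for a closed set `A` (such as each of the
spectra considered here) all stages are closed, so these are all its accumulation points. -/
noncomputable def acc (α : Ordinal.{0}) (A : Set ℂ) : Set ℂ :=
  CantorBendixson.iteratedDerivedSet A α

/-- The isolated points of `A`. -/
def iso (A : Set ℂ) : Set ℂ := A \ derivedSet A

/-- The commutant of `T`. -/
def comm (T : X →L[ℂ] X) : Set (X →L[ℂ] X) := Set.centralizer {T}

/-- The double commutant of `T`. -/
def comm2 (T : X →L[ℂ] X) : Set (X →L[ℂ] X) := Set.centralizer (comm T)

/-- `(M, N) ∈ Red(T)`: `M` and `N` are closed `T`-invariant subspaces and `X = M ⊕ N`. -/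
structure IsRed (T : X →L[ℂ] X) (M N : Submodule ℂ X) : Prop where
  inv_left : ∀ x ∈ M, T x ∈ M
  inv_right : ∀ x ∈ N, T x ∈ N
  closed_left : IsClosed (M : Set X)
  closed_right : IsClosed (N : Set X)
  isCompl : IsCompl M N

/-- `(M, N) ∈ Red²(T)`: the pair reduces every operator that commutes with `T`. -/
def IsRed2 (T : X →L[ℂ] X) (M N : Submodule ℂ X) : Prop :=
  ∀ S ∈ comm T, IsRed S M N

/-- `(M, N) ∈ D_al(T)`: `(M, N) ∈ Red(T)`, `T_M` is invertible and `σ(T_N)` is at most countable. -/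
def IsAlmostInvPair (T : X →L[ℂ] X) (M N : Submodule ℂ X) : Prop :=
  ∃ h : IsRed T M N, IsUnit (T.restrict h.inv_left) ∧
    (spectrum ℂ (T.restrict h.inv_right)).Countable

/-- `T` is almost invertible. -/
def IsAlmostInvertible (T : X →L[ℂ] X) : Prop :=
  ∃ M N : Submodule ℂ X, IsAlmostInvPair T M N

/-- Successor case of `g_{σ_*}^α`-invertibility, `α = β + 1`: there is `(M, N) ∈ Red(T)` with `T_M`
invertible and `acc^β σ_*(T_N) ⊆ {0}`. -/
def IsGInvertibleSucc (k : SpectrumKind) (β : Ordinal.{0}) (T : X →L[ℂ] X) : Prop :=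
  ∃ (M N : Submodule ℂ X) (h : IsRed T M N), IsUnit (T.restrict h.inv_left) ∧
    acc β (sigmaStar k (T.restrict h.inv_right)) ⊆ {0}

/-- `T` is `g_{σ_*}^α`-invertible: the cases `α = 0`, `α` a successor, `α` a limit ordinal. -/
def IsGInvertible (k : SpectrumKind) (α : Ordinal.{0}) (T : X →L[ℂ] X) : Prop :=
  (α = 0 ∧ (0 : ℂ) ∉ sigmaStar k T) ∨
  (∃ β : Ordinal.{0}, α = β + 1 ∧ IsGInvertibleSucc k β T) ∨
  (Order.IsSuccLimit α ∧ ∃ β : Ordinal.{0}, β + 1 < α ∧ IsGInvertibleSucc k β T)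

/-- `s` is a spectral set of `T`: a subset of `σ(T)` that is clopen in `σ(T)`. -/
def IsSpectralSet (T : X →L[ℂ] X) (s : Set ℂ) : Prop :=
  s ⊆ spectrum ℂ T ∧ IsClopen ((↑) ⁻¹' s : Set (spectrum ℂ T))

end Operators

end AlmostInv

/-! Every condition in the list says the same thing: `σ(T)` is at most countable in some
neighbourhood of `0` (`HasCountableSpectrumNearZero`). Three facts carry this.

Topology (`notMem_acc_omega_one_iff`): a closed planar set is countable near `x` iff `x` has left
its Cantor-Bendixson derivatives by stage `ω₁`. Condensation points survive every derivation. Near a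
point of countability the derivatives stabilise below `ω₁`; a stable nonempty piece would have a
perfect closure, hence be uncountable.

Comparison of spectra (`countable_inter_sigmaStar_iff`): a point of `σ(T)` outside `σ_*(T)` is
isolated in `σ(T)`, so the two sets differ by a countable set and are countable in the same places.

Riesz theory (`exists_idempotent_of_countable_nhds`): if `σ(T)` is countable near `0`, a thin
annulus around `0` misses it. Contour integrals of the resolvent then give an idempotent `p` and a
generalized inverse `s`, both in the double commutant, which supply the reducing pair and the
operators `P` and `S`. Conversely, each such decomposition makes `z - T` invertible on one summand
for `z` near `0`, so the spectrum near `0` comes from the countable part. -/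

open Filter Topology Set CantorBendixson

namespace AlmostInv

/-! ### Condensation points and stabilisation of Cantor-Bendixson derivatives below `ω₁`. -/

section Countability

universe u
variable {Y : Type u}

theorem isSuccLimit_omega_one : Order.IsSuccLimit (ω₁ : Ordinal.{u}) :=
  Cardinal.isSuccLimit_omega 1

/-- Subsets of a second countable space are Lindelöf, so countably many of the given neighbourhoods
cover `B`. -/
theorem countable_of_forall_nhds [TopologicalSpace Y] [SecondCountableTopology Y] {A B : Set Y}
    (hBA : B ⊆ A) (h : ∀ x ∈ B, ∃ U ∈ 𝓝 x, (U ∩ A).Countable) : B.Countable := by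
  have hL : IsLindelof B := HereditarilyLindelofSpace.isLindelof B
  have : (B ∩ A).Countable := by
    refine hL.induction_on (p := fun t => (t ∩ A).Countable) ?_ ?_ ?_
    · exact fun s t hst ht => ht.mono (inter_subset_inter_left _ hst)
    · intro S hS h
      rw [sUnion_eq_biUnion, iUnion₂_inter]
      exact hS.biUnion h
    · intro x hx
      obtain ⟨U, hU, hc⟩ := h x hx
      exact ⟨U, mem_nhdsWithin_of_mem_nhds hU, hc⟩
  rwa [inter_eq_left.2 hBA] at this

/-- The condensation points of a set survive every Cantor-Bendixson derivation. -/
theorem mem_iteratedDerivedSet_of_forall_not_countable [TopologicalSpace Y]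
    [SecondCountableTopology Y] {A : Set Y} {x : Y} (hx : x ∈ A)
    (h : ∀ U ∈ 𝓝 x, ¬ (U ∩ A).Countable) (a : Ordinal.{u}) : x ∈ iteratedDerivedSet A a := by
  set K : Set Y := {y ∈ A | ∀ U ∈ 𝓝 y, ¬ (U ∩ A).Countable} with hK
  have hKA : K ⊆ A := fun y hy => hy.1
  have hdiff : (A \ K).Countable := by
    refine countable_of_forall_nhds sdiff_subset fun y hy => ?_
    by_contra! hcon
    exact hy.2 ⟨hy.1, hcon⟩
  -- If a neighbourhood `U` of `y` met `K` in at most `y`, then `U ∩ A` would lie in the countable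
  -- set `{y} ∪ (A \ K)`.
  have hpre : Preperfect K := by
    rw [preperfect_iff_nhds]
    intro y hy U hU
    by_contra! hcon
    refine hy.2 U hU (((countable_singleton y).union hdiff).mono ?_)
    rintro z ⟨hzU, hzA⟩
    by_cases hz : z ∈ K
    · exact Or.inl (hcon z ⟨hzU, hz⟩)
    · exact Or.inr ⟨hzA, hz⟩
  have h1 : iteratedDerivedSet K a ⊆ iteratedDerivedSet A a := iteratedDerivedSet_mono hKA a
  rw [iteratedDerivedSet_constant_iff_preperfect.mp hpre a] at h1
  exact h1 ⟨hx, h⟩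

/-- Each point that is lost by stage `ω₁` is lost at some earlier stage, because `ω₁` is a limit;
over countably many points these stages have a supremum below `ω₁`. -/
theorem exists_lt_omega_one_inter_eq [TopologicalSpace Y] {A V : Set Y} (hV : (V ∩ A).Countable) :
    ∃ b < (ω₁ : Ordinal.{u}), V ∩ iteratedDerivedSet A b = V ∩ iteratedDerivedSet A ω₁ := by
  have key : ∀ y : ↥(V ∩ A), ∃ b < (ω₁ : Ordinal.{u}),
      (y : Y) ∈ iteratedDerivedSet A b → (y : Y) ∈ iteratedDerivedSet A ω₁ := by
    intro y
    by_contra! hcon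
    refine (hcon 0 (Ordinal.omega_pos 1)).2 ?_
    rw [iteratedDerivedSet_limit isSuccLimit_omega_one]
    exact mem_iInter.2 fun b => (hcon b b.2).1
  choose f hf hfA using key
  have : Countable ↥(V ∩ A) := hV.to_subtype
  refine ⟨⨆ y, f y, Ordinal.iSup_lt_omega_one hf, ?_⟩
  refine Subset.antisymm ?_ (inter_subset_inter_right _
    (iteratedDerivedSet_antitone A (Ordinal.iSup_lt_omega_one hf).le))
  rintro y ⟨hyV, hy⟩
  have hyA : y ∈ A := by
    simpa using iteratedDerivedSet_antitone A (zero_le (a := ⨆ y, f y)) hy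
  exact ⟨hyV, hfA ⟨y, hyV, hyA⟩ (iteratedDerivedSet_antitone A (Ordinal.le_iSup f _) hy)⟩

/-- Inside a small ball the stage `C` equals its own derivative, so that piece has no isolated
points. If it contained `x`, its closure would be nonempty and perfect and would contain a Cantor
set, yet it lies in the countable set `U ∩ A`. -/
theorem notMem_iteratedDerivedSet_omega_one [MetricSpace Y] [CompleteSpace Y]
    {A : Set Y} (hA : IsClosed A) {x : Y} {U : Set Y} (hU : U ∈ 𝓝 x) (hc : (U ∩ A).Countable) :
    x ∉ iteratedDerivedSet A ω₁ := by
  intro hx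
  obtain ⟨r, hr, hrU⟩ := Metric.nhds_basis_closedBall.mem_iff.1 hU
  obtain ⟨b, hb, hbV⟩ := exists_lt_omega_one_inter_eq
    (V := Metric.ball x r)
    (hc.mono (inter_subset_inter_left A (Metric.ball_subset_closedBall.trans hrU)))
  set C := iteratedDerivedSet A b with hC
  have hCcl : IsClosed C := isClosed_iteratedDerivedSet hA b
  have hCA : C ⊆ A := by simpa using iteratedDerivedSet_antitone A (zero_le (a := b))
  have hlim : b + 1 ≤ ω₁ := (isSuccLimit_omega_one.add_one_lt hb).le
  have hsub : Metric.ball x r ∩ C ⊆ derivedSet C := by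
    rw [hbV]
    rintro y ⟨-, hy⟩
    have := iteratedDerivedSet_antitone A hlim hy
    rw [iteratedDerivedSet_succ] at this
    exact this.1
  have hpre : Preperfect (Metric.ball x r ∩ C) := fun y hy =>
    (hsub hy).nhds_inter (Metric.isOpen_ball.mem_nhds hy.1)
  have hxC : x ∈ Metric.ball x r ∩ C := by
    rw [hbV]; exact ⟨Metric.mem_ball_self hr, hx⟩
  have hperf := hpre.perfect_closure
  obtain ⟨f, hfr, -, hfi⟩ := hperf.exists_nat_bool_injection ⟨x, subset_closure hxC⟩
  have hcl : closure (Metric.ball x r ∩ C) ⊆ U ∩ A := by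
    refine (closure_minimal ?_ (Metric.isClosed_closedBall.inter hCcl)).trans
      (inter_subset_inter hrU hCA)
    exact inter_subset_inter_left _ Metric.ball_subset_closedBall
  have hcount : (range f).Countable := hc.mono (hfr.trans hcl)
  have h2 : Countable (ℕ → Bool) := by
    rw [← image_univ] at hcount
    exact countable_univ_iff.1 (countable_of_injective_of_countable_image hfi.injOn hcount)
  have h3 := Cardinal.mk_le_aleph0_iff.2 h2
  simp only [Cardinal.mk_pi, Cardinal.mk_bool, Cardinal.prod_const, Cardinal.lift_id,
    Cardinal.mk_nat] at h3
  exact absurd (Cardinal.cantor Cardinal.aleph0) (not_lt.2 (by simpa using h3))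

end Countability

/-! ### Derivatives of closed planar sets and local countability. -/

section Acc

variable {A : Set ℂ}

theorem acc_zero : acc 0 A = A := iteratedDerivedSet_zero

theorem acc_antitone {a b : Ordinal.{0}} (h : a ≤ b) : acc b A ⊆ acc a A :=
  iteratedDerivedSet_antitone A h

theorem acc_subset (a : Ordinal.{0}) : acc a A ⊆ A := by
  simpa [acc_zero] using acc_antitone (A := A) (zero_le (a := a))

theorem acc_add_one (a : Ordinal.{0}) : acc (a + 1) A = derivedSet (acc a A) ∩ acc a A :=
  iteratedDerivedSet_succ

/-- A point lies outside `acc^{ω₁} A` if and only if `A` is countable near it. -/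
theorem notMem_acc_omega_one_iff (hA : IsClosed A) {x : ℂ} :
    x ∉ acc ω₁ A ↔ ∃ U ∈ 𝓝 x, (U ∩ A).Countable := by
  refine ⟨fun h => ?_, fun ⟨U, hU, hc⟩ => notMem_iteratedDerivedSet_omega_one hA hU hc⟩
  by_cases hx : x ∈ A
  · by_contra! hcon
    exact h (mem_iteratedDerivedSet_of_forall_not_countable hx hcon _)
  · exact ⟨Aᶜ, hA.isOpen_compl.mem_nhds hx, by simp⟩

theorem countable_diff_acc_omega_one (hA : IsClosed A) : (A \ acc ω₁ A).Countable :=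
  countable_of_forall_nhds sdiff_subset fun _ hx => (notMem_acc_omega_one_iff hA).1 hx.2

theorem exists_acc_eq_empty (hA : IsClosed A) (hc : A.Countable) : ∃ b < ω₁, acc b A = ∅ := by
  obtain ⟨b, hb, h⟩ := exists_lt_omega_one_inter_eq (A := A) (V := univ) (by simpa)
  refine ⟨b, hb, ?_⟩
  rw [univ_inter, univ_inter] at h
  rw [acc, h, eq_empty_iff_forall_notMem]
  exact fun x => (notMem_acc_omega_one_iff hA).2 ⟨univ, univ_mem, by simpa⟩

theorem acc_add_one_eq_empty {a : Ordinal.{0}} {z : ℂ} (h : acc a A ⊆ {z}) :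
    acc (a + 1) A = ∅ := by
  rw [acc_add_one, eq_empty_iff_forall_notMem]
  rintro x ⟨hx, hxA⟩
  have h1 := h hxA
  rw [mem_singleton_iff] at h1
  subst h1
  obtain ⟨y, hy, hne⟩ := accPt_iff_nhds.1 (mem_derivedSet.1 hx) univ univ_mem
  exact hne (h hy.2)

/-- A point that has left by stage `ω₁` is isolated in some earlier stage. -/
theorem exists_mem_iso_acc {x : ℂ} (hx : x ∈ A) (h : x ∉ acc ω₁ A) :
    ∃ b < ω₁, x ∈ iso (acc b A) := by
  by_contra! hcon
  have : ∀ a ≤ (ω₁ : Ordinal.{0}), x ∈ acc a A := by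
    intro a
    induction a using Ordinal.limitRecOn with
    | zero => intro _; rwa [acc_zero]
    | add_one a ih =>
      intro ha
      have ha' : a < ω₁ := (lt_add_one a).trans_le ha
      have h1 := ih ha'.le
      have h2 := hcon a ha'
      rw [acc_add_one]
      refine ⟨?_, h1⟩
      by_contra h3
      exact h2 ⟨h1, h3⟩
    | limit a ha ih =>
      intro hle
      rw [acc, iteratedDerivedSet_limit ha]
      exact mem_iInter.2 fun b => ih b b.2 (le_of_lt (lt_of_lt_of_le b.2 hle))
  exact h (this _ le_rfl)

theorem iso_acc_subset_diff {b : Ordinal.{0}} (hb : b < ω₁) : iso (acc b A) ⊆ A \ acc ω₁ A := by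
  rintro x ⟨hx, hx'⟩
  refine ⟨acc_subset b hx, fun h => hx' ?_⟩
  have := acc_antitone (isSuccLimit_omega_one.add_one_lt hb).le h
  rw [acc_add_one] at this
  exact this.1

end Acc

end AlmostInv

namespace AlmostInv

/-! ### Riesz idempotents and generalized inverses in a Banach algebra. -/

section BanachAlgebra

open Metric Complex

variable {A : Type*} [NormedRing A] [NormedAlgebra ℂ A] [CompleteSpace A]

/-- The Laurent coefficient `(2πi)⁻¹ ∮ zⁿ (z - a)⁻¹ dz` of the resolvent on `|z| = r`. -/
noncomputable def laurentCoeff (a : A) (r : ℝ) (n : ℤ) : A :=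
  (2 * Real.pi * I : ℂ)⁻¹ • ∮ z in C(0, r), z ^ n • resolvent a z

theorem continuousOn_zpow_smul_resolvent (a : A) (n : ℤ) {s : Set ℂ}
    (hs : s ⊆ resolventSet ℂ a) (h0 : (0 : ℂ) ∉ s) :
    ContinuousOn (fun z : ℂ => z ^ n • resolvent a z) s := fun z hz =>
  (((continuousAt_zpow₀ z n (Or.inl fun h => h0 (h ▸ hz))).smul
    (spectrum.hasDerivAt_resolvent_const_left (hs hz)).continuousAt)).continuousWithinAt

theorem zero_notMem_sphere {r : ℝ} (hr : 0 < r) : (0 : ℂ) ∉ sphere (0 : ℂ) r := by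
  simp [hr.ne]

/-- Integrate `a * resolvent a z = z • resolvent a z - 1` against `z ^ n`; the integral of `z ^ n`
over the circle vanishes unless `n = -1`. -/
theorem mul_laurentCoeff {a : A} {r : ℝ} (hr : 0 < r)
    (h : sphere (0 : ℂ) r ⊆ resolventSet ℂ a) (n : ℤ) :
    a * laurentCoeff a r n = laurentCoeff a r (n + 1) - if n = -1 then 1 else 0 := by
  have hint : ∀ m : ℤ, CircleIntegrable (fun z : ℂ => z ^ m • resolvent a z) 0 r := fun m =>
    (continuousOn_zpow_smul_resolvent a m h (zero_notMem_sphere hr)).circleIntegrable hr.le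
  have h1 : a * ∮ z in C(0, r), z ^ n • resolvent a z
      = ∮ z in C(0, r), (z ^ (n + 1) • resolvent a z - z ^ n • (1 : A)) := by
    rw [show a * ∮ z in C(0, r), z ^ n • resolvent a z
      = ∮ z in C(0, r), a * (z ^ n • resolvent a z) from ?_]
    · refine circleIntegral.integral_congr hr.le fun z hz => ?_
      have hz0 : z ≠ 0 := fun h0 => zero_notMem_sphere hr (h0 ▸ hz)
      have hu : (algebraMap ℂ A z - a) * resolvent a z = 1 := Ring.mul_inverse_cancel _ (h hz)
      have : a * resolvent a z = z • resolvent a z - 1 := by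
        rw [sub_mul, Algebra.algebraMap_eq_smul_one, smul_mul_assoc, one_mul] at hu
        rw [← hu]; abel
      simp only [mul_smul_comm, this, smul_sub, smul_smul, zpow_add_one₀ hz0]
    · have := (ContinuousLinearMap.mul ℂ A a).intervalIntegral_comp_comm (hint n).out
      simp only [ContinuousLinearMap.mul_apply'] at this
      simp only [circleIntegral]
      rw [← this]
      simp
  have h2 : (∮ z in C(0, r), z ^ n • (1 : A)) = (if n = -1 then (2 * Real.pi * I : ℂ) else 0) • 1 := by
    rw [circleIntegral.integral_smul_const]
    split_ifs with hn
    · subst hn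
      have := circleIntegral.integral_sub_center_inv 0 hr.ne'
      simp only [sub_zero] at this
      simp [this]
    · have := circleIntegral.integral_sub_zpow_of_ne hn 0 0 r
      simp only [sub_zero] at this
      rw [this]
  have hint1 : CircleIntegrable (fun z : ℂ => z ^ n • (1 : A)) 0 r := by
    refine ContinuousOn.circleIntegrable hr.le fun z hz => ?_
    exact ((continuousAt_zpow₀ z n (Or.inl fun h0 => zero_notMem_sphere hr (h0 ▸ hz))).smul
      continuousAt_const).continuousWithinAt
  rw [laurentCoeff, mul_smul_comm, h1, circleIntegral.integral_sub (hint _) hint1, smul_sub, h2,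
    laurentCoeff]
  split_ifs <;> simp [smul_smul, Real.pi_ne_zero, -mul_inv_rev]

theorem commute_laurentCoeff {a b : A} (hab : Commute b a) {r : ℝ} (hr : 0 < r)
    (h : sphere (0 : ℂ) r ⊆ resolventSet ℂ a) (n : ℤ) : Commute b (laurentCoeff a r n) := by
  have hint : CircleIntegrable (fun z : ℂ => z ^ n • resolvent a z) 0 r :=
    (continuousOn_zpow_smul_resolvent a n h (zero_notMem_sphere hr)).circleIntegrable hr.le
  have h1 := (ContinuousLinearMap.mul ℂ A b).intervalIntegral_comp_comm hint.out
  have h2 := ((ContinuousLinearMap.mul ℂ A).flip b).intervalIntegral_comp_comm hint.out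
  have h3 : ∀ z ∈ sphere (0 : ℂ) r, Commute b (resolvent a z) := fun z hz => by
    have hu : IsUnit (algebraMap ℂ A z - a) := h hz
    have hc : Commute b (algebraMap ℂ A z - a) := (Algebra.commute_algebraMap_right z b).sub_right hab
    obtain ⟨u, hu⟩ := hu
    rw [resolvent, ← hu, Ring.inverse_unit]
    rw [← hu] at hc
    exact hc.units_inv_right
  refine Commute.smul_right ?_ _
  simp only [ContinuousLinearMap.mul_apply', ContinuousLinearMap.flip_apply] at h1 h2
  rw [commute_iff_eq, circleIntegral, ← h1, ← h2]
  congr 1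
  funext θ
  simp only [mul_smul_comm, smul_mul_assoc, (h3 _ (circleMap_mem_sphere 0 hr.le θ)).eq]

/-- One constant serves all integers `n`, of both signs; comparing the growth at two radii replaces
the usual double contour integral. -/
theorem norm_laurentCoeff_le {a : A} {r : ℝ} (hr : 0 < r)
    (h : sphere (0 : ℂ) r ⊆ resolventSet ℂ a) :
    ∃ C, ∀ n : ℤ, ‖laurentCoeff a r n‖ ≤ C * r ^ n := by
  have hc : ContinuousOn (resolvent a) (sphere (0 : ℂ) r) := fun z hz =>
    (spectrum.hasDerivAt_resolvent_const_left (h hz)).continuousAt.continuousWithinAt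
  obtain ⟨C, hC⟩ := (isCompact_sphere (0 : ℂ) r).exists_bound_of_continuousOn hc
  refine ⟨r * C, fun n => ?_⟩
  have := circleIntegral.norm_two_pi_i_inv_smul_integral_le_of_norm_le_const (c := 0)
    (f := fun z : ℂ => z ^ n • resolvent a z) (C := r ^ n * C) hr.le fun z hz => by
      rw [norm_smul, norm_zpow, mem_sphere_zero_iff_norm.1 hz]
      exact mul_le_mul_of_nonneg_left (hC z hz) (by positivity)
  rw [laurentCoeff]
  linarith

theorem laurentCoeff_eq {a : A} {r R : ℝ} (hr : 0 < r) (hrR : r ≤ R)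
    (h : closedBall (0 : ℂ) R \ ball 0 r ⊆ resolventSet ℂ a) (n : ℤ) :
    laurentCoeff a r n = laurentCoeff a R n := by
  have h0 : (0 : ℂ) ∉ closedBall (0 : ℂ) R \ ball 0 r := fun h => h.2 (mem_ball_self hr)
  rw [laurentCoeff, laurentCoeff]
  congr 1
  refine (circleIntegral_eq_of_differentiable_on_annulus_off_countable hr hrR countable_empty
    (continuousOn_zpow_smul_resolvent a n h h0) ?_).symm
  rintro z ⟨⟨hz1, hz2⟩, -⟩
  have hz : z ∈ closedBall (0 : ℂ) R \ ball 0 r :=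
    ⟨ball_subset_closedBall hz1, fun h => hz2 (ball_subset_closedBall h)⟩
  exact (differentiableAt_zpow.2 (Or.inl fun e => h0 (by subst e; exact hz))).smul
    (spectrum.hasDerivAt_resolvent_const_left (h hz)).differentiableAt

/-- The Riesz idempotent of the part of the spectrum inside an annulus contained in the resolvent
set, together with the inverse of `a` on the complementary part. -/
theorem exists_riesz_idempotent {a : A} {r R : ℝ} (hr : 0 < r) (hrR : r < R)
    (h : closedBall (0 : ℂ) R \ ball 0 r ⊆ resolventSet ℂ a) :
    ∃ p s : A, (∀ b, Commute b a → Commute b p ∧ Commute b s) ∧ IsIdempotentElem p ∧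
      s * a = 1 - p ∧ s ^ 2 * a = s ∧ spectrum ℂ (a * p) ⊆ closedBall 0 r := by
  have hsr : sphere (0 : ℂ) r ⊆ resolventSet ℂ a := fun z hz => h <| by
    rw [mem_sphere_zero_iff_norm] at hz
    simp [hz, hrR.le]
  have hsR : sphere (0 : ℂ) R ⊆ resolventSet ℂ a := fun z hz => h <| by
    rw [mem_sphere_zero_iff_norm] at hz
    simp [hz, hrR.le]
  have hR := hr.trans hrR
  -- `p` is the Riesz idempotent, and `v` satisfies `a * v = p - 1`, so `-v` inverts `a` on the
  -- complementary part.
  set p := laurentCoeff a r 0 with hp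
  set v := laurentCoeff a R (-1) with hv
  have hpR : p = laurentCoeff a R 0 := laurentCoeff_eq hr hrR.le h 0
  have hcp : ∀ b, Commute b a → Commute b p := fun b hb => commute_laurentCoeff hb hr hsr 0
  have hcn : ∀ b, Commute b a → ∀ n, Commute b (laurentCoeff a R n) :=
    fun b hb n => commute_laurentCoeff hb hR hsR n
  have hpow : ∀ n : ℕ, a ^ n * p = laurentCoeff a r n := by
    intro n
    induction n with
    | zero => simp [hp]
    | succ n ih =>
      rw [pow_succ', mul_assoc, ih, mul_laurentCoeff hr hsr, if_neg (by omega)]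
      simp
  have hav : a * v = p - 1 := by
    rw [hv, mul_laurentCoeff hR hsR, if_pos rfl, hpR]; simp
  have hneg : ∀ n : ℕ, a ^ (n + 1) * laurentCoeff a R (-(n + 1 : ℕ)) = p - 1 := by
    intro n
    induction n with
    | zero => simpa using hav
    | succ n ih =>
      rw [pow_succ, mul_assoc, mul_laurentCoeff hR hsR, if_neg (by omega), sub_zero, ← ih]
      congr 2
  obtain ⟨C₁, hC₁⟩ := norm_laurentCoeff_le hr hsr
  obtain ⟨C₂, hC₂⟩ := norm_laurentCoeff_le hR hsR
  have haa : Commute a a := Commute.refl a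
  -- For every `n` this product equals the coefficient of index `-(n+1)` at radius `R` times that of
  -- index `n+1` at radius `r`, hence is `O((r/R)^(n+1))`.
  have hzero : (p - 1) * p = 0 := by
    have hle : ∀ n : ℕ, ‖(p - 1) * p‖ ≤ C₂ * C₁ * (r / R) ^ (n + 1) := by
      intro n
      have e : (p - 1) * p = laurentCoeff a R (-(n + 1 : ℕ)) * laurentCoeff a r (n + 1 : ℕ) := by
        rw [← hneg n, ← hpow (n + 1), ← mul_assoc]
        congr 1
        exact ((hcn a haa _).pow_left _).eq
      rw [e]
      refine (norm_mul_le _ _).trans ?_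
      refine (mul_le_mul (hC₂ _) (hC₁ _) (norm_nonneg _) ((norm_nonneg _).trans (hC₂ _))).trans
        (le_of_eq ?_)
      rw [zpow_neg, zpow_natCast, zpow_natCast, div_pow]
      ring
    have hlim : Tendsto (fun n : ℕ => C₂ * C₁ * (r / R) ^ (n + 1)) atTop (𝓝 (C₂ * C₁ * 0)) :=
      ((tendsto_pow_atTop_nhds_zero_of_lt_one (by positivity)
        ((div_lt_one hR).2 hrR)).comp (tendsto_add_atTop_nat 1)).const_mul _
    rw [mul_zero] at hlim
    exact norm_le_zero_iff.1 (ge_of_tendsto' hlim hle)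
  have hpp : p * p = p := by
    rw [sub_mul, one_mul, sub_eq_zero] at hzero
    exact hzero
  have hpa : Commute a p := hcp a haa
  have hvp : Commute v p := hcp v (hcn a haa _).symm
  have hva : Commute a v := hcn a haa _
  have hsa : v * (p - 1) * a = 1 - p := by
    have : v * (p - 1) * a = (a * v) * (p - 1) := by
      rw [mul_assoc, mul_assoc, hva.left_comm, (hpa.sub_right (Commute.one_right a)).eq]
    rw [this, hav, sub_mul, mul_sub, hpp]
    simp
  -- The factor `p - 1` corrects the sign of `v` and kills the range of `p`.
  refine ⟨p, v * (p - 1), fun b hb => ⟨hcp b hb, (hcn b hb _).mul_right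
    ((hcp b hb).sub_right (Commute.one_right b))⟩, hpp, hsa, ?_, ?_⟩
  · rw [sq, mul_assoc, hsa]
    simp only [mul_sub, sub_mul, mul_assoc, hpp, mul_one]
    abel
  · intro z hz
    rw [mem_closedBall_zero_iff]
    by_contra! hlt
    -- Here `(a * p) ^ (n + 1) = a ^ (n + 1) * p` is a Laurent coefficient of norm at most `C₁ * r ^
    -- (n + 1)`, which bounds `‖z‖ ^ (n + 1)`. The exponent is positive because `p ^ 0` is not `p`.
    have hle : ∀ n : ℕ, (‖z‖ / r) ^ (n + 1) ≤ C₁ * ‖(1 : A)‖ := by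
      intro n
      have h1 := spectrum.norm_le_norm_mul_of_mem (spectrum.pow_mem_pow (a * p) (n + 1) hz)
      have h2 : (a * p) ^ (n + 1) = laurentCoeff a r (n + 1 : ℕ) := by
        rw [hpa.mul_pow, (show IsIdempotentElem p from hpp).pow_succ_eq, hpow]
      rw [h2, norm_pow] at h1
      rw [div_pow, div_le_iff₀ (by positivity)]
      refine h1.trans ((mul_le_mul_of_nonneg_right (hC₁ _) (norm_nonneg _)).trans (le_of_eq ?_))
      rw [zpow_natCast]
      ring
    have := (tendsto_pow_atTop_atTop_of_one_lt ((one_lt_div hr).2 hlt)).comp (tendsto_add_atTop_nat 1)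
    obtain ⟨n, hn⟩ := (this.eventually_gt_atTop (C₁ * ‖(1 : A)‖)).exists
    exact absurd (hle n) (not_le.2 hn)

/-- If the spectrum is countable near `0`, some annulus around `0` lies in the resolvent set. -/
theorem exists_annulus {s U : Set ℂ} (hs : IsClosed s) (hU : U ∈ 𝓝 (0 : ℂ))
    (hc : (U ∩ s).Countable) :
    ∃ r R : ℝ, 0 < r ∧ r < R ∧ closedBall (0 : ℂ) R ⊆ U ∧
      closedBall (0 : ℂ) R \ ball 0 r ⊆ sᶜ := by
  obtain ⟨e, he, heU⟩ := Metric.nhds_basis_closedBall.mem_iff.1 hU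
  have h1 : ((fun z : ℂ => ‖z‖) '' (U ∩ s)).Countable := hc.image _
  -- The moduli of the spectral points in `U` are countable, so some radius `t` avoids them;
  -- compactness widens this to an interval of radii.
  obtain ⟨t, ⟨ht0, hte⟩, ht⟩ : (Ioo 0 e \ ((fun z : ℂ => ‖z‖) '' (U ∩ s))).Nonempty := by
    by_contra! hcon
    have : Ioo 0 e ⊆ ((fun z : ℂ => ‖z‖) '' (U ∩ s)) := sdiff_eq_empty.1 hcon
    exact (Cardinal.Real.Ioo_countable_iff.1 (h1.mono this)).not_gt he
  have hK : IsClosed ((fun z : ℂ => ‖z‖) '' (closedBall 0 e ∩ s)) :=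
    (((isCompact_closedBall (0 : ℂ) e).inter_right hs).image continuous_norm).isClosed
  have htK : t ∈ ((fun z : ℂ => ‖z‖) '' (closedBall 0 e ∩ s))ᶜ := fun h =>
    ht (image_mono (inter_subset_inter_left s heU) h)
  obtain ⟨d, hd, hdK⟩ := Metric.isOpen_iff.1 hK.isOpen_compl t htK
  refine ⟨t, min (t + d / 2) e, ht0, lt_min (by linarith) hte,
    (closedBall_subset_closedBall (min_le_right _ _)).trans heU, ?_⟩
  rintro z ⟨hz1, hz2⟩ hzs
  rw [mem_closedBall_zero_iff, le_min_iff] at hz1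
  rw [mem_ball_zero_iff, not_lt] at hz2
  refine hdK (?_ : ‖z‖ ∈ ball t d) ⟨z, ⟨mem_closedBall_zero_iff.2 hz1.2, hzs⟩, rfl⟩
  rw [Metric.mem_ball, Real.dist_eq, abs_of_nonneg (by linarith)]
  linarith [hz1.1]

/-- Elements of this form multiply componentwise, so `b⁻¹ * (1 - p) + c⁻¹ * p` is the inverse. This
is how invertibility is glued from the two summands cut out by `p`. -/
theorem isUnit_mul_one_sub_add_mul {R : Type*} [Ring R] {b c p : R} (hp : IsIdempotentElem p)
    (hb : IsUnit b) (hc : IsUnit c) (hpb : Commute p b) (hpc : Commute p c) :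
    IsUnit (b * (1 - p) + c * p) := by
  obtain ⟨b, rfl⟩ := hb
  obtain ⟨c, rfl⟩ := hc
  have hp' : p * p = p := hp
  have hb' := hpb.units_inv_right.eq
  have hc' := hpc.units_inv_right.eq
  have hb := hpb.eq
  have hc := hpc.eq
  have e1 : (1 - p) * p = 0 := by rw [sub_mul, hp', one_mul, sub_self]
  have e2 : p * (1 - p) = 0 := by rw [mul_sub, hp', mul_one, sub_self]
  have e3 : (1 - p) * (1 - p) = 1 - p := hp.one_sub
  have key : ∀ x y x' y' : R, p * x' = x' * p → p * y' = y' * p →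
      (x * (1 - p) + y * p) * (x' * (1 - p) + y' * p) = x * x' * (1 - p) + y * y' * p := by
    intro x y x' y' hx hy
    have hx' : (1 - p) * x' = x' * (1 - p) := by rw [sub_mul, mul_sub, hx, one_mul, mul_one]
    have hy' : (1 - p) * y' = y' * (1 - p) := by rw [sub_mul, mul_sub, hy, one_mul, mul_one]
    calc (x * (1 - p) + y * p) * (x' * (1 - p) + y' * p)
        = x * ((1 - p) * x') * (1 - p) + x * ((1 - p) * y') * p
          + (y * (p * x') * (1 - p) + y * (p * y') * p) := by noncomm_ring
      _ = x * x' * ((1 - p) * (1 - p)) + x * y' * ((1 - p) * p)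
          + (y * x' * (p * (1 - p)) + y * y' * (p * p)) := by
          rw [hx', hy', hx, hy]; simp only [mul_assoc]
      _ = x * x' * (1 - p) + y * y' * p := by rw [e1, e2, e3, hp']; simp
  refine ⟨⟨_, (↑b⁻¹ : R) * (1 - p) + ↑c⁻¹ * p, ?_, ?_⟩, rfl⟩
  · rw [key _ _ _ _ hb' hc']; simp
  · rw [key _ _ _ _ hb hc]; simp

omit [CompleteSpace A] in
theorem spectrum_mul_idempotent_subset {a p : A} (hp : IsIdempotentElem p) (hpa : Commute p a) :
    spectrum ℂ (a * p) ⊆ {0} ∪ spectrum ℂ a := by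
  intro z hz
  by_contra! hcon
  rw [mem_union, not_or, mem_singleton_iff] at hcon
  obtain ⟨hz0, hza⟩ := hcon
  rw [spectrum.notMem_iff] at hza
  refine hz ?_
  have := isUnit_mul_one_sub_add_mul hp ((isUnit_iff_ne_zero.2 hz0).map (algebraMap ℂ A)) hza
    (Algebra.commute_algebraMap_right z p) ((Algebra.commute_algebraMap_right z p).sub_right hpa)
  have e : algebraMap ℂ A z - a * p = algebraMap ℂ A z * (1 - p) + (algebraMap ℂ A z - a) * p := by
    noncomm_ring
  rw [resolventSet, mem_ofPred_eq, e]
  exact this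

theorem isIdempotentElem_of_generalized_inverse {R : Type*} [Ring R] {a s : R}
    (hsa : Commute s a) (hs : s ^ 2 * a = s) : IsIdempotentElem (s * a) := by
  have e : s * a * s = s := by rw [mul_assoc, ← hsa.eq, ← mul_assoc, ← sq, hs]
  rw [IsIdempotentElem, ← mul_assoc, e]

/-- If `s` is a generalized inverse of `a`, then near `0` the element `z - a` agrees on the range of
the idempotent `s * a` with an invertible element. -/
theorem exists_nhds_isUnit_mul_eq {a s : A} (hsa : Commute s a) (hs : s ^ 2 * a = s) :
    ∃ U ∈ 𝓝 (0 : ℂ), ∀ z ∈ U, ∃ b : A, IsUnit b ∧ Commute (1 - s * a) b ∧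
      b * (s * a) = (algebraMap ℂ A z - a) * (s * a) := by
  have hs' : s * s * a = s := by rw [← sq, hs]
  have e1 : s * (s * a) = s := by rw [← mul_assoc, hs']
  have e2 : s * a * s = s := by rw [mul_assoc, ← hsa.eq, e1]
  have hq : (s * a) * (s * a) = s * a := by rw [← mul_assoc, e2]
  have hqa : Commute (s * a) a := hsa.mul_left (Commute.refl a)
  have hqs : Commute (s * a) s := (Commute.refl s).mul_left hsa.symm
  have hopen : IsOpen {z : ℂ | IsUnit (algebraMap ℂ A z * s - 1)} :=
    Units.isOpen.preimage (by fun_prop)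
  refine ⟨_, hopen.mem_nhds (by simp), fun z hz => ?_⟩
  -- On the range of `q = s * a` the inverse of `a` is `s`. There `z - a = (z s - 1) a`, and `z s -
  -- 1` is a unit for `z` near `0`.
  have hu : IsUnit (a * (s * a) + (1 - s * a)) := by
    refine ⟨⟨_, s + (1 - s * a), ?_, ?_⟩, rfl⟩
    · have h1 : a * (s * a) * s = s * a := by rw [mul_assoc, e2, hsa.eq]
      have h2 : a * (s * a) * (s * a) = a * (s * a) := by rw [mul_assoc, hq]
      calc (a * (s * a) + (1 - s * a)) * (s + (1 - s * a))
          = a * (s * a) * s + a * (s * a) - a * (s * a) * (s * a) + s - s * a * s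
            + 1 - s * a - s * a + (s * a) * (s * a) := by noncomm_ring
        _ = 1 := by rw [h1, h2, e2, hq]; abel
    · have h1 : s * (a * (s * a)) = s * a := by rw [← mul_assoc, hq]
      have h2 : s * a * (a * (s * a)) = a * (s * a) := by
        rw [hqa.left_comm, hq]
      calc (s + (1 - s * a)) * (a * (s * a) + (1 - s * a))
          = s * (a * (s * a)) + s - s * (s * a) + a * (s * a) - s * a * (a * (s * a))
            + 1 - s * a - s * a + (s * a) * (s * a) := by noncomm_ring
        _ = 1 := by rw [h1, h2, e1, hq]; abel
  refine ⟨(algebraMap ℂ A z * s - 1) * (a * (s * a) + (1 - s * a)), IsUnit.mul hz hu, ?_, ?_⟩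
  · refine (Commute.one_left _).sub_left (Commute.mul_right ?_ ?_)
    · exact ((Algebra.commute_algebraMap_right z _).mul_right hqs).sub_right (Commute.one_right _)
    · exact (hqa.mul_right (Commute.refl _)).add_right
        ((Commute.one_right _).sub_right (Commute.refl _))
  · have h1 : (a * (s * a) + (1 - s * a)) * (s * a) = a * (s * a) := by
      rw [add_mul, sub_mul, one_mul, hq, sub_self, add_zero, mul_assoc, hq]
    have h2 : s * (a * (s * a)) = s * a := by rw [← mul_assoc, hq]
    rw [mul_assoc, h1, sub_mul, mul_assoc, h2, one_mul, sub_mul]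

/-- Locally countable spectrum at `0` gives a Riesz idempotent in the double commutant. -/
theorem exists_idempotent_of_countable_nhds {a : A}
    (h : ∃ U ∈ 𝓝 (0 : ℂ), (U ∩ spectrum ℂ a).Countable) :
    ∃ p s : A, (∀ b, Commute b a → Commute b p ∧ Commute b s) ∧ IsIdempotentElem p ∧
      s * a = 1 - p ∧ s ^ 2 * a = s ∧ (spectrum ℂ (a * p)).Countable := by
  obtain ⟨U, hU, hc⟩ := h
  obtain ⟨r, R, hr, hrR, hRU, hann⟩ := exists_annulus (spectrum.isClosed a) hU hc
  obtain ⟨p, s, hcomm, hp, hs, hss, hsp⟩ := exists_riesz_idempotent hr hrR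
    (fun z hz => not_not.1 (hann hz))
  refine ⟨p, s, hcomm, hp, hs, hss, ((countable_singleton 0).union hc).mono fun z hz => ?_⟩
  rcases spectrum_mul_idempotent_subset hp (hcomm a (Commute.refl a)).1.symm hz with h0 | h0
  · exact Or.inl h0
  · exact Or.inr ⟨hRU (closedBall_subset_closedBall hrR.le (hsp hz)), h0⟩

/-- Near `0`, `z - a` is harmless on the range of `s * a`, and on the other summand it agrees with
`z - a * (1 - s * a)`. -/
theorem countable_nhds_of_generalized_inverse {a s : A} (hsa : Commute s a) (hs : s ^ 2 * a = s)
    (hc : (spectrum ℂ (a * (1 - s * a))).Countable) :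
    ∃ U ∈ 𝓝 (0 : ℂ), (U ∩ spectrum ℂ a).Countable := by
  obtain ⟨U, hU, hUb⟩ := exists_nhds_isUnit_mul_eq hsa hs
  refine ⟨U, hU, hc.mono ?_⟩
  rintro z ⟨hzU, hz⟩
  by_contra hcon
  rw [spectrum.notMem_iff] at hcon
  obtain ⟨b, hb, hbc, hbe⟩ := hUb z hzU
  have hq : IsIdempotentElem (s * a) := isIdempotentElem_of_generalized_inverse hsa hs
  have hpa : Commute (1 - s * a) a :=
    (Commute.one_left a).sub_left (hsa.mul_left (Commute.refl a))
  have := isUnit_mul_one_sub_add_mul hq.one_sub hb hcon hbc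
    ((Algebra.commute_algebraMap_right z _).sub_right (hpa.mul_right (Commute.refl _)))
  refine hz ?_
  rw [resolventSet, mem_ofPred_eq]
  convert this using 1
  rw [sub_sub_cancel, hbe]
  have h2 : (1 - s * a) * (1 - s * a) = 1 - s * a := hq.one_sub
  rw [sub_mul (algebraMap ℂ A z) (a * (1 - s * a)), mul_assoc a, h2]
  noncomm_ring

/-- Adding `1 - s * a` leaves the range of `s * a` untouched and translates the other summand by
`1`, so the spectrum near `0` lies in a translate of a countable set. -/
theorem countable_nhds_add_idempotent {a s : A} (hsa : Commute s a) (hs : s ^ 2 * a = s)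
    (hc : (spectrum ℂ (a * (1 - s * a))).Countable) :
    ∃ U ∈ 𝓝 (0 : ℂ), (U ∩ spectrum ℂ (a + (1 - s * a))).Countable := by
  obtain ⟨U, hU, hUb⟩ := exists_nhds_isUnit_mul_eq hsa hs
  refine ⟨U, hU, (hc.image (fun z => z + 1)).mono ?_⟩
  rintro z ⟨hzU, hz⟩
  refine ⟨z - 1, ?_, by ring⟩
  by_contra hcon
  rw [spectrum.notMem_iff] at hcon
  obtain ⟨b, hb, hbc, hbe⟩ := hUb z hzU
  have hq : IsIdempotentElem (s * a) := isIdempotentElem_of_generalized_inverse hsa hs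
  have hpa : Commute (1 - s * a) a :=
    (Commute.one_left a).sub_left (hsa.mul_left (Commute.refl a))
  have := isUnit_mul_one_sub_add_mul hq.one_sub hb hcon hbc
    ((Algebra.commute_algebraMap_right _ _).sub_right (hpa.mul_right (Commute.refl _)))
  refine hz ?_
  rw [resolventSet, mem_ofPred_eq]
  convert this using 1
  rw [sub_sub_cancel, hbe]
  have h2 : (1 - s * a) * (1 - s * a) = 1 - s * a := hq.one_sub
  rw [sub_mul (algebraMap ℂ A (z - 1)) (a * (1 - s * a)), mul_assoc a, h2, map_sub, map_one]
  noncomm_ring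

-- On the range of `1 - p` the element `a` agrees with `a + p`, and on the range of `p` with `a *
-- p`.
omit [CompleteSpace A] in
theorem countable_nhds_of_add_idempotent {a p : A} (hp : IsIdempotentElem p) (hpa : Commute p a)
    (h : ∃ U ∈ 𝓝 (0 : ℂ), (U ∩ spectrum ℂ (a + p)).Countable)
    (hc : (spectrum ℂ (a * p)).Countable) :
    ∃ U ∈ 𝓝 (0 : ℂ), (U ∩ spectrum ℂ a).Countable := by
  obtain ⟨U, hU, hUc⟩ := h
  refine ⟨U, hU, (hUc.union hc).mono ?_⟩
  rintro z ⟨hzU, hz⟩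
  by_contra hcon
  rw [mem_union, not_or, mem_inter_iff, not_and, spectrum.notMem_iff, spectrum.notMem_iff] at hcon
  have := isUnit_mul_one_sub_add_mul hp (hcon.1 hzU) hcon.2
    ((Algebra.commute_algebraMap_right _ _).sub_right (hpa.add_right (Commute.refl _)))
    ((Algebra.commute_algebraMap_right _ _).sub_right (hpa.mul_right (Commute.refl _)))
  refine hz ?_
  rw [resolventSet, mem_ofPred_eq]
  convert this using 1
  have hp' : p * p = p := hp
  rw [sub_mul (algebraMap ℂ A z) (a * p), mul_assoc a, hp', sub_mul _ (a + p), add_mul,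
    mul_sub p, hp']
  noncomm_ring

end BanachAlgebra

end AlmostInv

namespace AlmostInv

/-! ### Spectra along a reducing pair. -/

section Reduction

variable {X : Type*} [NormedAddCommGroup X] [NormedSpace ℂ X]

theorem IsRed.symm {T : X →L[ℂ] X} {M N : Submodule ℂ X} (h : IsRed T M N) : IsRed T N M :=
  ⟨h.inv_right, h.inv_left, h.closed_right, h.closed_left, h.isCompl.symm⟩

theorem algebraMap_sub_apply_mem {T : X →L[ℂ] X} {M : Submodule ℂ X} (h : ∀ x ∈ M, T x ∈ M)
    (z : ℂ) : ∀ x ∈ M, (algebraMap ℂ (X →L[ℂ] X) z - T) x ∈ M := fun x hx =>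
  M.sub_mem (M.smul_mem z hx) (h x hx)

theorem restrict_algebraMap_sub {T : X →L[ℂ] X} {M : Submodule ℂ X} (h : ∀ x ∈ M, T x ∈ M)
    (z : ℂ) : (algebraMap ℂ (X →L[ℂ] X) z - T).restrict (algebraMap_sub_apply_mem h z) =
      algebraMap ℂ (M →L[ℂ] M) z - T.restrict h := rfl

theorem IsRed.algebraMap_sub {T : X →L[ℂ] X} {M N : Submodule ℂ X} (h : IsRed T M N) (z : ℂ) :
    IsRed (algebraMap ℂ (X →L[ℂ] X) z - T) M N :=
  ⟨algebraMap_sub_apply_mem h.inv_left z, algebraMap_sub_apply_mem h.inv_right z, h.closed_left,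
    h.closed_right, h.isCompl⟩

theorem bijective_of_restrict {T : X →L[ℂ] X} {M N : Submodule ℂ X} (hMN : IsCompl M N)
    (hM : ∀ x ∈ M, T x ∈ M) (hN : ∀ x ∈ N, T x ∈ N) (h1 : Function.Bijective (T.restrict hM))
    (h2 : Function.Bijective (T.restrict hN)) : Function.Bijective T := by
  constructor
  · rw [injective_iff_map_eq_zero]
    intro x hx
    obtain ⟨m, hm, n, hn, rfl⟩ := Submodule.mem_sup.1 (hMN.sup_eq_top ▸ Submodule.mem_top (x := x))
    rw [map_add] at hx
    have hTm : T m = 0 := Submodule.disjoint_def.1 hMN.disjoint _ (hM m hm)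
      (by rw [eq_neg_of_add_eq_zero_left hx]; exact N.neg_mem (hN n hn))
    rw [hTm, zero_add] at hx
    have e1 := (injective_iff_map_eq_zero _).1 h1.1 ⟨m, hm⟩ (Subtype.ext hTm)
    have e2 := (injective_iff_map_eq_zero _).1 h2.1 ⟨n, hn⟩ (Subtype.ext hx)
    rw [show m = 0 from congrArg Subtype.val e1, show n = 0 from congrArg Subtype.val e2, add_zero]
  · intro y
    obtain ⟨m, hm, n, hn, rfl⟩ := Submodule.mem_sup.1 (hMN.sup_eq_top ▸ Submodule.mem_top (x := y))
    obtain ⟨u, hu⟩ := h1.2 ⟨m, hm⟩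
    obtain ⟨v, hv⟩ := h2.2 ⟨n, hn⟩
    refine ⟨u + v, ?_⟩
    rw [map_add]
    exact congrArg₂ (· + ·) (congrArg Subtype.val hu) (congrArg Subtype.val hv)

theorem bijective_restrict {T : X →L[ℂ] X} {M N : Submodule ℂ X} (hMN : IsCompl M N)
    (hM : ∀ x ∈ M, T x ∈ M) (hN : ∀ x ∈ N, T x ∈ N) (h : Function.Bijective T) :
    Function.Bijective (T.restrict hM) := by
  constructor
  · intro x y hxy
    exact Subtype.ext (h.1 (congrArg Subtype.val hxy))
  · rintro ⟨y, hy⟩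
    obtain ⟨x, rfl⟩ := h.2 y
    obtain ⟨m, hm, n, hn, rfl⟩ := Submodule.mem_sup.1 (hMN.sup_eq_top ▸ Submodule.mem_top (x := x))
    rw [map_add] at hy
    have hTn : T n = 0 := Submodule.disjoint_def.1 hMN.disjoint _
      ((M.add_mem_iff_right (hM m hm)).1 hy) (hN n hn)
    refine ⟨⟨m, hm⟩, Subtype.ext ?_⟩
    simp [hTn]

variable [CompleteSpace X]

theorem IsRed.isUnit_iff {T : X →L[ℂ] X} {M N : Submodule ℂ X} (h : IsRed T M N) :
    IsUnit T ↔ IsUnit (T.restrict h.inv_left) ∧ IsUnit (T.restrict h.inv_right) := by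
  have := h.closed_left.completeSpace_coe
  have := h.closed_right.completeSpace_coe
  simp only [ContinuousLinearMap.isUnit_iff_bijective]
  exact ⟨fun hT => ⟨bijective_restrict h.isCompl h.inv_left h.inv_right hT,
    bijective_restrict h.isCompl.symm h.inv_right h.inv_left hT⟩,
    fun hT => bijective_of_restrict h.isCompl _ _ hT.1 hT.2⟩

theorem IsRed.spectrum_eq {T : X →L[ℂ] X} {M N : Submodule ℂ X} (h : IsRed T M N) :
    spectrum ℂ T = spectrum ℂ (T.restrict h.inv_left) ∪ spectrum ℂ (T.restrict h.inv_right) := by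
  ext z
  rw [mem_union, spectrum.mem_iff, spectrum.mem_iff, spectrum.mem_iff,
    (h.algebraMap_sub z).isUnit_iff, not_and_or]
  rfl

end Reduction

/-! ### Drazin and Browder spectra compared with the spectrum. -/

section Drazin

variable {X : Type*} [NormedAddCommGroup X] [NormedSpace ℂ X]

theorem range_pow_add_eq {T : X →L[ℂ] X} {q : ℕ} (h : (T ^ q).range = (T ^ (q + 1)).range) (n : ℕ) :
    (T ^ (q + n)).range = (T ^ q).range := by
  induction n with
  | zero => rfl
  | succ n ih =>
    ext y
    rw [← ih]
    constructor
    · rintro ⟨x, rfl⟩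
      refine ⟨T x, ?_⟩
      rw [← add_assoc, pow_succ]
      rfl
    · rintro ⟨x, rfl⟩
      have hx : (T ^ q) x ∈ (T ^ (q + 1)).range := h ▸ ⟨x, rfl⟩
      obtain ⟨w, hw⟩ := hx
      refine ⟨w, ?_⟩
      have hw' : (T ^ (q + 1)) w = (T ^ q) x := hw
      change (T ^ (q + (n + 1))) w = (T ^ (q + n)) x
      rw [show q + (n + 1) = n + (q + 1) by ring, show q + n = n + q by ring, pow_add,
        pow_add T n q, mul_apply_eq_comp, mul_apply_eq_comp, hw']

theorem ker_pow_add_eq {T : X →L[ℂ] X} {p : ℕ} (h : (T ^ p).ker = (T ^ (p + 1)).ker) (n : ℕ) :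
    (T ^ (p + n)).ker = (T ^ p).ker := by
  induction n with
  | zero => rfl
  | succ n ih =>
    ext x
    rw [← ih]
    have e : ∀ y, (T ^ p) y = 0 ↔ (T ^ (p + 1)) y = 0 := fun y => SetLike.ext_iff.1 h y
    have := e ((T ^ n) x)
    simp only [← mul_apply_eq_comp, ← pow_add] at this
    rw [show p + 1 + n = p + (n + 1) by ring] at this
    exact this.symm

theorem IsDrazinInvertible.exists_pow {T : X →L[ℂ] X} (h : IsDrazinInvertible T) :
    ∃ n : ℕ, IsCompl (T ^ (n + 1)).range (T ^ (n + 1)).ker := by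
  obtain ⟨⟨p, hp⟩, ⟨q, hq⟩⟩ := h
  -- Passing to `p + 1` makes the final exponent positive, which is what lets `T` itself be
  -- bijective on the range of the power.
  replace hp := (ker_pow_add_eq hp 1).trans (ker_pow_add_eq hp 2).symm
  refine ⟨p + q, ?_⟩
  rw [show p + q + 1 = (p + 1) + q by ring]
  rw [show p + 2 = p + 1 + 1 from rfl] at hp
  generalize p + 1 = p at hp ⊢
  refine ⟨?_, ?_⟩
  · rw [Submodule.disjoint_def]
    rintro _ ⟨x, rfl⟩ hx
    have h1 : x ∈ (T ^ (p + (q + (p + q)))).ker := by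
      rw [← add_assoc, pow_add]
      exact hx
    rw [ker_pow_add_eq hp, ← ker_pow_add_eq hp q] at h1
    exact h1
  · rw [codisjoint_iff, eq_top_iff]
    intro x _
    have h1 : (T ^ (p + q)) x ∈ (T ^ (q + (p + (p + q)))).range := by
      rw [range_pow_add_eq hq, ← range_pow_add_eq hq p, add_comm q p]
      exact ⟨x, rfl⟩
    obtain ⟨w, hw⟩ := h1
    have hw' : (T ^ (q + (p + (p + q)))) w = (T ^ (p + q)) x := hw
    rw [show q + (p + (p + q)) = (p + q) + (p + q) by ring, pow_add,
      mul_apply_eq_comp] at hw'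
    refine Submodule.mem_sup.2 ⟨(T ^ (p + q)) w, ⟨w, rfl⟩, x - (T ^ (p + q)) w, ?_, by abel⟩
    rw [LinearMap.mem_ker]
    change (T ^ (p + q)) (x - (T ^ (p + q)) w) = 0
    rw [map_sub, hw', sub_self]

theorem isBrowder_of_isUnit {T : X →L[ℂ] X} (h : IsUnit T) : IsBrowder T := by
  refine ⟨?_, ⟨0, ?_⟩, ⟨0, ?_⟩⟩
  · obtain ⟨u, rfl⟩ := h
    exact .of_isQuasiInverse (v := (↑u⁻¹ : X →L[ℂ] X))
      (ContinuousLinearEquiv.unitsEquiv ℂ X u).toLinearEquiv.isQuasiInverse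
  · obtain ⟨u, rfl⟩ := h
    ext x
    simp only [pow_zero, zero_add, pow_one, LinearMap.mem_ker]
    change x = 0 ↔ (u : X →L[ℂ] X) x = 0
    refine ⟨fun hx => by rw [hx, map_zero], fun hx => ?_⟩
    have : ((↑u⁻¹ : X →L[ℂ] X) * u) x = 0 := by rw [mul_apply_eq_comp, hx, map_zero]
    rwa [u.inv_mul] at this
  · obtain ⟨u, rfl⟩ := h
    ext x
    refine ⟨fun _ => ⟨(↑u⁻¹ : X →L[ℂ] X) x, ?_⟩, fun _ => ⟨x, rfl⟩⟩
    change ((↑u : X →L[ℂ] X) ^ (0 + 1)) ((↑u⁻¹ : X →L[ℂ] X) x) = x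
    rw [zero_add, pow_one, ← mul_apply_eq_comp, u.mul_inv]
    rfl

variable [CompleteSpace X]

omit [CompleteSpace X] in
theorem isUnit_sub_smul_one_iff (T : X →L[ℂ] X) (z : ℂ) :
    IsUnit (T - z • (1 : X →L[ℂ] X)) ↔ z ∉ spectrum ℂ T := by
  rw [spectrum.notMem_iff, Algebra.algebraMap_eq_smul_one, ← neg_sub, IsUnit.neg_iff]

omit [CompleteSpace X] in
theorem pow_apply_comm (T : X →L[ℂ] X) (n : ℕ) (x : X) : (T ^ n) (T x) = T ((T ^ n) x) := by
  rw [← mul_apply_eq_comp, ← mul_apply_eq_comp, ← pow_succ, ← pow_succ']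

theorem isRed_range_ker_pow {T : X →L[ℂ] X} {n : ℕ} (hn : IsCompl (T ^ n).range (T ^ n).ker) :
    IsRed T (T ^ n).range (T ^ n).ker := by
  have hNcl : IsClosed ((T ^ n).ker : Set X) := (T ^ n).isClosed_ker
  refine ⟨?_, ?_, ?_, hNcl, hn⟩
  · rintro _ ⟨x, rfl⟩
    exact ⟨T x, pow_apply_comm T n x⟩
  · intro x hx
    have hx' : (T ^ n) x = 0 := hx
    change (T ^ n) (T x) = 0
    rw [pow_apply_comm, hx', map_zero]
  -- The range is closed because it is the range of the injective map induced on the quotient by the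
  -- kernel, and it has a closed algebraic complement.
  · generalize T ^ n = S at hn hNcl ⊢
    have hf : (S.ker.liftQL S le_rfl).range = S.range := Submodule.range_liftQ _ _ _
    have hk : (S.ker.liftQL S le_rfl).ker = ⊥ := Submodule.ker_liftQ_eq_bot _ _ _ le_rfl
    rw [← hf] at hn ⊢
    exact (S.ker.liftQL S le_rfl).closed_complemented_range_of_isCompl_of_ker_eq_bot S.ker hn hNcl hk

omit [CompleteSpace X] in
theorem bijective_restrict_range_pow {T : X →L[ℂ] X} {m : ℕ}
    (hn : IsCompl (T ^ (m + 1)).range (T ^ (m + 1)).ker)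
    (h : ∀ x ∈ (T ^ (m + 1)).range, T x ∈ (T ^ (m + 1)).range) :
    Function.Bijective (T.restrict h) := by
  rw [Function.Bijective, injective_iff_map_eq_zero]
  refine ⟨fun x hx => Subtype.ext (Submodule.disjoint_def.1 hn.disjoint _ x.2 ?_), ?_⟩
  · have hx' : T x = 0 := congrArg Subtype.val hx
    have e : (T ^ (m + 1)) (x : X) = (T ^ m) (T x) :=
      congrArg (fun S : X →L[ℂ] X => S (x : X)) (pow_succ T m)
    exact e.trans (by rw [hx', map_zero])
  · rintro ⟨_, x, rfl⟩
    obtain ⟨_, ⟨w, rfl⟩, v, hv, rfl⟩ :=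
      Submodule.mem_sup.1 (hn.sup_eq_top ▸ Submodule.mem_top (x := x))
    have hv' : (T ^ (m + 1)) v = 0 := hv
    refine ⟨⟨(T ^ (m + 1)) ((T ^ m) w), ⟨_, rfl⟩⟩, Subtype.ext ?_⟩
    change T ((T ^ (m + 1)) ((T ^ m) w)) = (T ^ (m + 1)) ((T ^ (m + 1)) w + v)
    rw [map_add, hv', add_zero, ← pow_apply_comm, ← mul_apply_eq_comp T, ← pow_succ']

omit [CompleteSpace X] in
theorem restrict_pow_apply {T : X →L[ℂ] X} {N : Submodule ℂ X} (h : ∀ x ∈ N, T x ∈ N) (j : ℕ)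
    (x : N) : (((T.restrict h) ^ j) x : X) = (T ^ j) x := by
  induction j generalizing x with
  | zero => rfl
  | succ j ih =>
    rw [pow_succ, pow_succ, mul_apply_eq_comp, ih]
    rfl

omit [CompleteSpace X] in
theorem spectrum_restrict_ker_pow_subset {T : X →L[ℂ] X} {n : ℕ}
    (h : ∀ x ∈ (T ^ n).ker, T x ∈ (T ^ n).ker) : spectrum ℂ (T.restrict h) ⊆ {0} := by
  intro z hz
  have hnil : (T.restrict h) ^ n = 0 := by
    ext x
    rw [restrict_pow_apply]
    exact x.2
  have := spectrum.pow_mem_pow _ n hz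
  rw [hnil] at this
  by_contra hz0
  refine this ?_
  rw [spectrum.mem_resolventSet_iff, sub_zero]
  exact (isUnit_iff_ne_zero.2 (pow_ne_zero n hz0)).map (algebraMap ℂ ((T ^ n).ker →L[ℂ] (T ^ n).ker))

/-- A Drazin invertible operator has `0` outside the accumulation points of its spectrum. -/
theorem IsDrazinInvertible.eventually_notMem_spectrum {T : X →L[ℂ] X} (h : IsDrazinInvertible T) :
    ∀ᶠ z in 𝓝 (0 : ℂ), z ≠ 0 → z ∉ spectrum ℂ T := by
  obtain ⟨m, hn⟩ := h.exists_pow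
  have hred := isRed_range_ker_pow hn
  have := hred.closed_left.completeSpace_coe
  have hM0 := ContinuousLinearMap.isUnit_iff_bijective.2
    (bijective_restrict_range_pow hn hred.inv_left)
  have h1 := (spectrum.isClosed (𝕜 := ℂ) (T.restrict hred.inv_left)).isOpen_compl.mem_nhds
    ((spectrum.zero_notMem_iff ℂ).2 hM0)
  filter_upwards [h1] with z hz hz0
  rw [hred.spectrum_eq, mem_union, not_or]
  exact ⟨hz, fun hzN => hz0 (spectrum_restrict_ker_pow_subset hred.inv_right hzN)⟩

omit [CompleteSpace X] in
theorem sigmaStar_subset (k : SpectrumKind) (T : X →L[ℂ] X) : sigmaStar k T ⊆ spectrum ℂ T := by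
  intro z hz
  by_contra h
  have hb := isBrowder_of_isUnit ((isUnit_sub_smul_one_iff T z).2 h)
  cases k with
  | usual => exact h hz
  | browder => exact hz hb
  | drazin => exact hz hb.2

/-- In all three cases `T - z` is Drazin invertible, hence invertible plus nilpotent along range and
kernel of a power. This yields both closedness of `σ_*` and countability of `σ \ σ_*`. -/
theorem eventually_notMem_spectrum_of_notMem_sigmaStar {k : SpectrumKind} {T : X →L[ℂ] X} {z : ℂ}
    (h : z ∉ sigmaStar k T) : ∀ᶠ w in 𝓝 z, w ≠ z → w ∉ spectrum ℂ T := by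
  have hd : IsDrazinInvertible (T - z • (1 : X →L[ℂ] X)) := by
    cases k with
    | usual => exact (isBrowder_of_isUnit ((isUnit_sub_smul_one_iff T z).2 h)).2
    | browder => exact (not_not.1 h).2
    | drazin => exact not_not.1 h
  have h1 := hd.eventually_notMem_spectrum
  have h2 : Tendsto (fun w => w - z) (𝓝 z) (𝓝 0) := by
    have : Continuous fun w : ℂ => w - z := by fun_prop
    simpa using this.tendsto z
  filter_upwards [h2.eventually h1] with w hw hwz
  have := hw (sub_ne_zero.2 hwz)
  rw [spectrum.notMem_iff] at this ⊢
  convert this using 1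
  rw [map_sub, ← Algebra.algebraMap_eq_smul_one]
  abel

theorem isClosed_sigmaStar (k : SpectrumKind) (T : X →L[ℂ] X) : IsClosed (sigmaStar k T) := by
  rw [← isOpen_compl_iff, isOpen_iff_mem_nhds]
  intro z hz
  filter_upwards [eventually_notMem_spectrum_of_notMem_sigmaStar hz] with w hw hws
  by_cases e : w = z
  · exact hz (e ▸ hws)
  · exact hw e (sigmaStar_subset k T hws)

theorem countable_diff_sigmaStar (k : SpectrumKind) (T : X →L[ℂ] X) :
    (spectrum ℂ T \ sigmaStar k T).Countable := by
  refine countable_of_forall_nhds sdiff_subset fun z hz => ⟨_,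
    eventually_notMem_spectrum_of_notMem_sigmaStar hz.2, (countable_singleton z).mono ?_⟩
  rintro w ⟨hw, hws⟩
  by_contra hne
  exact hw hne hws

theorem countable_inter_sigmaStar_iff (k : SpectrumKind) (T : X →L[ℂ] X) (U : Set ℂ) :
    (U ∩ sigmaStar k T).Countable ↔ (U ∩ spectrum ℂ T).Countable := by
  refine ⟨fun h => (h.union (countable_diff_sigmaStar k T)).mono ?_,
    fun h => h.mono (inter_subset_inter_right _ (sigmaStar_subset k T))⟩
  rintro z ⟨hzU, hz⟩
  by_cases hs : z ∈ sigmaStar k T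
  · exact Or.inl ⟨hzU, hs⟩
  · exact Or.inr ⟨hz, hs⟩

theorem countable_sigmaStar_iff (k : SpectrumKind) (T : X →L[ℂ] X) :
    (sigmaStar k T).Countable ↔ (spectrum ℂ T).Countable := by
  simpa using countable_inter_sigmaStar_iff k T univ

end Drazin

end AlmostInv

namespace AlmostInv

/-! ### Each condition against countability of the spectrum near `0`. -/

section Characterizations

variable {X : Type*} [NormedAddCommGroup X] [NormedSpace ℂ X] {T : X →L[ℂ] X}

theorem mem_comm_iff {S : X →L[ℂ] X} : S ∈ comm T ↔ Commute S T := by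
  simp only [comm, Set.mem_centralizer_iff, mem_singleton_iff, forall_eq]
  exact eq_comm

theorem mem_comm2_iff {S : X →L[ℂ] X} : S ∈ comm2 T ↔ ∀ R, Commute R T → Commute R S := by
  simp only [comm2, Set.mem_centralizer_iff, mem_comm_iff]
  rfl

theorem comm2_subset_comm : comm2 T ⊆ comm T := fun _ hS =>
  mem_comm_iff.2 (mem_comm2_iff.1 hS T (Commute.refl T)).symm

/-- The spectrum of `T` is at most countable in a neighbourhood of `0`. -/
def HasCountableSpectrumNearZero (T : X →L[ℂ] X) : Prop :=
  ∃ U ∈ 𝓝 (0 : ℂ), (U ∩ spectrum ℂ T).Countable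

/-- The operator induced on the quotient by an invariant subspace. -/
def quotientMap (T : X →L[ℂ] X) (N : Submodule ℂ X) (hN : ∀ x ∈ N, T x ∈ N) :
    (X ⧸ N) →L[ℂ] (X ⧸ N) :=
  N.liftQL (N.mkQL ∘L T) fun x hx => (Submodule.Quotient.mk_eq_zero N).2 (hN x hx)

theorem quotientMap_mk {N : Submodule ℂ X} (hN : ∀ x ∈ N, T x ∈ N) (x : X) :
    quotientMap T N hN (Submodule.Quotient.mk x) = Submodule.Quotient.mk (T x) := rfl

theorem quotientMap_algebraMap_sub {N : Submodule ℂ X} (hN : ∀ x ∈ N, T x ∈ N) (z : ℂ) :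
    quotientMap (algebraMap ℂ (X →L[ℂ] X) z - T) N (algebraMap_sub_apply_mem hN z) =
      algebraMap ℂ ((X ⧸ N) →L[ℂ] (X ⧸ N)) z - quotientMap T N hN := by
  ext x
  obtain ⟨x, rfl⟩ := Submodule.Quotient.mk_surjective N x
  rfl

theorem bijective_of_quotientMap {N : Submodule ℂ X} (hN : ∀ x ∈ N, T x ∈ N)
    (h1 : Function.Bijective (T.restrict hN)) (h2 : Function.Bijective (quotientMap T N hN)) :
    Function.Bijective T := by
  constructor
  · rw [injective_iff_map_eq_zero]
    intro x hx
    have h3 : (Submodule.Quotient.mk x : X ⧸ N) = 0 :=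
      (injective_iff_map_eq_zero _).1 h2.1 _ (by rw [quotientMap_mk, hx]; rfl)
    have hxN := (Submodule.Quotient.mk_eq_zero N).1 h3
    exact congrArg Subtype.val ((injective_iff_map_eq_zero _).1 h1.1 ⟨x, hxN⟩ (Subtype.ext hx))
  · intro y
    obtain ⟨x, hx⟩ := h2.2 (Submodule.Quotient.mk y)
    obtain ⟨x, rfl⟩ := Submodule.Quotient.mk_surjective N x
    rw [quotientMap_mk, eq_comm, Submodule.Quotient.eq] at hx
    obtain ⟨n, hn⟩ := h1.2 ⟨_, hx⟩
    refine ⟨n + x, ?_⟩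
    have hn' : T n = y - T x := congrArg Subtype.val hn
    rw [map_add, hn', sub_add_cancel]

theorem bijective_quotientMap {M N : Submodule ℂ X} (hMN : IsCompl M N) (hM : ∀ x ∈ M, T x ∈ M)
    (hN : ∀ x ∈ N, T x ∈ N) (h : Function.Bijective (T.restrict hM)) :
    Function.Bijective (quotientMap T N hN) := by
  constructor
  · rw [injective_iff_map_eq_zero]
    intro x hx
    obtain ⟨x, rfl⟩ := Submodule.Quotient.mk_surjective N x
    obtain ⟨m, hm, n, hn, rfl⟩ := Submodule.mem_sup.1 (hMN.sup_eq_top ▸ Submodule.mem_top (x := x))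
    rw [quotientMap_mk, Submodule.Quotient.mk_eq_zero, map_add,
      N.add_mem_iff_left (hN n hn)] at hx
    have hTm : T m = 0 := Submodule.disjoint_def.1 hMN.disjoint _ (hM m hm) hx
    have hm0 : m = 0 :=
      congrArg Subtype.val ((injective_iff_map_eq_zero _).1 h.1 ⟨m, hm⟩ (Subtype.ext hTm))
    rw [hm0, zero_add]
    exact (Submodule.Quotient.mk_eq_zero N).2 hn
  · intro y
    obtain ⟨y, rfl⟩ := Submodule.Quotient.mk_surjective N y
    obtain ⟨m, hm, n, hn, rfl⟩ := Submodule.mem_sup.1 (hMN.sup_eq_top ▸ Submodule.mem_top (x := y))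
    obtain ⟨u, hu⟩ := h.2 ⟨m, hm⟩
    refine ⟨Submodule.Quotient.mk (u : X), ?_⟩
    have hu' : T u = m := congrArg Subtype.val hu
    rw [quotientMap_mk, hu', Submodule.Quotient.eq, sub_add_cancel_left]
    exact N.neg_mem hn

variable [CompleteSpace X]

theorem spectrum_subset_union_quotientMap {N : Submodule ℂ X} [hcl : IsClosed (N : Set X)]
    (hN : ∀ x ∈ N, T x ∈ N) :
    spectrum ℂ T ⊆ spectrum ℂ (T.restrict hN) ∪ spectrum ℂ (quotientMap T N hN) := by
  have := hcl.completeSpace_coe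
  intro z hz
  by_contra hcon
  rw [mem_union, not_or, spectrum.notMem_iff, spectrum.notMem_iff, ← restrict_algebraMap_sub,
    ← quotientMap_algebraMap_sub, ContinuousLinearMap.isUnit_iff_bijective,
    ContinuousLinearMap.isUnit_iff_bijective] at hcon
  exact hz (ContinuousLinearMap.isUnit_iff_bijective.2 (bijective_of_quotientMap _ hcon.1 hcon.2))

/-- `M` need not be closed, so the Banach space `X ⧸ N` replaces it: `T` induces a bijection there,
which is invertible by the open mapping theorem and stays so after small shifts. -/
theorem hasCountableSpectrumNearZero_of_isCompl {M N : Submodule ℂ X} (hNcl : IsClosed (N : Set X))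
    (hMN : IsCompl M N) (hM : ∀ x ∈ M, T x ∈ M) (hN : ∀ x ∈ N, T x ∈ N)
    (h : Function.Bijective (T.restrict hM)) (hc : (spectrum ℂ (T.restrict hN)).Countable) :
    HasCountableSpectrumNearZero T := by
  have : IsClosed (N : Set X) := hNcl
  have hu := ContinuousLinearMap.isUnit_iff_bijective.2 (bijective_quotientMap hMN hM hN h)
  refine ⟨_, (spectrum.isClosed (𝕜 := ℂ) (quotientMap T N hN)).isOpen_compl.mem_nhds
    ((spectrum.zero_notMem_iff ℂ).2 hu), hc.mono ?_⟩
  rintro z ⟨hz1, hz⟩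
  exact (spectrum_subset_union_quotientMap hN hz).resolve_right hz1

theorem IsAlmostInvPair.hasCountableSpectrumNearZero {M N : Submodule ℂ X}
    (h : IsAlmostInvPair T M N) : HasCountableSpectrumNearZero T := by
  obtain ⟨h, hu, hc⟩ := h
  have := h.closed_left.completeSpace_coe
  exact hasCountableSpectrumNearZero_of_isCompl h.closed_right h.isCompl _ _
    (ContinuousLinearMap.isUnit_iff_bijective.1 hu) hc

omit [CompleteSpace X] in
theorem isRed_ker_range {P S : X →L[ℂ] X} (hP : IsIdempotentElem P) (hS : Commute S P) :
    IsRed S P.ker P.range := by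
  have hPP : ∀ x, P (P x) = P x := fun x => congrArg (fun R : X →L[ℂ] X => R x) hP
  have hSP : ∀ x, S (P x) = P (S x) := fun x => congrArg (fun R : X →L[ℂ] X => R x) hS
  refine ⟨?_, ?_, P.isClosed_ker, ?_, ?_, ?_⟩
  · intro x hx
    have hx' : P x = 0 := hx
    change P (S x) = 0
    rw [← hSP, hx', map_zero]
  · rintro _ ⟨x, rfl⟩
    exact ⟨S x, (hSP x).symm⟩
  · have : (P.range : Set X) = {x | P x = x} := by
      ext x
      exact ⟨fun ⟨y, hy⟩ => hy ▸ hPP y, fun hx => ⟨x, hx⟩⟩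
    rw [this]
    exact isClosed_eq P.continuous continuous_id
  · rw [Submodule.disjoint_def]
    rintro _ hx ⟨y, rfl⟩
    exact (hPP y).symm.trans hx
  · rw [codisjoint_iff, eq_top_iff]
    intro x _
    refine Submodule.mem_sup.2 ⟨x - P x, ?_, P x, ⟨x, rfl⟩, sub_add_cancel _ _⟩
    change P (x - P x) = 0
    rw [map_sub, hPP, sub_self]

theorem HasCountableSpectrumNearZero.exists_isRed2 (h : HasCountableSpectrumNearZero T) :
    ∃ M N : Submodule ℂ X, IsRed2 T M N ∧ IsAlmostInvPair T M N := by
  obtain ⟨p, s, hcomm, hp, hs, -, hc⟩ := exists_idempotent_of_countable_nhds h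
  have hred : IsRed T p.ker p.range := isRed_ker_range hp (hcomm T (Commute.refl T)).1
  have hcs : Commute T s := (hcomm T (Commute.refl T)).2
  have hreds : IsRed s p.ker p.range := isRed_ker_range hp (hcomm s hcs.symm).1
  have hsT : ∀ x ∈ p.ker, s (T x) = x := fun x hx => by
    have h1 : s (T x) = x - p x := congrArg (fun R : X →L[ℂ] X => R x) hs
    rw [h1, show p x = 0 from hx, sub_zero]
  have hTs : ∀ x, T (s x) = s (T x) := fun x => congrArg (fun R : X →L[ℂ] X => R x) hcs
  refine ⟨p.ker, p.range, fun S hS => isRed_ker_range hp (hcomm S (mem_comm_iff.1 hS)).1, hred,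
    -- Since `s * T = 1 - p`, the restriction of `s` inverts `T` on the kernel of `p`.
    ⟨⟨_, s.restrict hreds.inv_left, ?_, ?_⟩, rfl⟩, ?_⟩
  · ext x
    exact (hTs x).trans (hsT x x.2)
  · ext x
    exact hsT x x.2
  · have hredp : IsRed (T * p) p.ker p.range := isRed_ker_range hp
      ((hcomm T (Commute.refl T)).1.mul_left (Commute.refl p))
    have e : (T * p).restrict hredp.inv_right = T.restrict hred.inv_right := by
      ext ⟨_, x, rfl⟩
      exact congrArg T (congrArg (fun R : X →L[ℂ] X => R x) hp)
    rw [← e]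
    refine hc.mono ?_
    rw [hredp.spectrum_eq]
    exact subset_union_right

theorem isAlmostInvertible_iff : IsAlmostInvertible T ↔ HasCountableSpectrumNearZero T := by
  refine ⟨fun ⟨M, N, h⟩ => h.hasCountableSpectrumNearZero, fun h => ?_⟩
  obtain ⟨M, N, -, h⟩ := h.exists_isRed2
  exact ⟨M, N, h⟩

theorem notMem_acc_omega_one_sigmaStar_iff (k : SpectrumKind) :
    (0 : ℂ) ∉ acc ω₁ (sigmaStar k T) ↔ HasCountableSpectrumNearZero T := by
  rw [notMem_acc_omega_one_iff (isClosed_sigmaStar k T)]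
  simp only [countable_inter_sigmaStar_iff]
  rfl

theorem isGInvertible_omega_one_iff (k : SpectrumKind) :
    IsGInvertible k ω₁ T ↔ HasCountableSpectrumNearZero T := by
  have hsucc : IsGInvertible k ω₁ T ↔ ∃ β : Ordinal.{0}, β + 1 < ω₁ ∧ IsGInvertibleSucc k β T := by
    refine ⟨?_, fun h => Or.inr (Or.inr ⟨isSuccLimit_omega_one, h⟩)⟩
    rintro (⟨h, -⟩ | ⟨β, h, -⟩ | ⟨-, h⟩)
    · exact absurd h (Ordinal.omega_pos 1).ne'
    · have h1 : β < ω₁ := h ▸ lt_add_one β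
      exact absurd (isSuccLimit_omega_one.add_one_lt h1) (h ▸ lt_irrefl _)
    · exact h
  rw [hsucc, ← isAlmostInvertible_iff]
  constructor
  · rintro ⟨β, hβ, M, N, h, hu, hacc⟩
    have := h.closed_right.completeSpace_coe
    refine ⟨M, N, h, hu, (countable_sigmaStar_iff k _).1 ?_⟩
    -- One derivation beyond `β` removes the possible last point `0`, and `β + 1` is still below
    -- `ω₁`.
    have hempty : acc ω₁ (sigmaStar k (T.restrict h.inv_right)) = ∅ :=
      subset_empty_iff.1 ((acc_antitone hβ.le).trans (acc_add_one_eq_empty hacc).subset)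
    have := countable_diff_acc_omega_one (isClosed_sigmaStar k (T.restrict h.inv_right))
    rwa [hempty, sdiff_empty] at this
  · rintro ⟨M, N, h, hu, hc⟩
    have := h.closed_right.completeSpace_coe
    obtain ⟨β, hβ, he⟩ := exists_acc_eq_empty (isClosed_sigmaStar k (T.restrict h.inv_right))
      ((countable_sigmaStar_iff k _).2 hc)
    exact ⟨β, isSuccLimit_omega_one.add_one_lt hβ, M, N, h, hu, he ▸ empty_subset _⟩

theorem exists_isCompl_iff (k : SpectrumKind) :
    (∃ (M N : Submodule ℂ X) (hM : ∀ x ∈ M, T x ∈ M) (hN : ∀ x ∈ N, T x ∈ N),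
        IsClosed (N : Set X) ∧ IsCompl M N ∧ Function.Bijective (T.restrict hM) ∧
          (sigmaStar k (T.restrict hN)).Countable) ↔ HasCountableSpectrumNearZero T := by
  constructor
  · rintro ⟨M, N, hM, hN, hcl, hMN, hb, hc⟩
    have := hcl.completeSpace_coe
    exact hasCountableSpectrumNearZero_of_isCompl hcl hMN hM hN hb
      ((countable_sigmaStar_iff k _).1 hc)
  · intro h
    obtain ⟨M, N, h, hu, hc⟩ := isAlmostInvertible_iff.2 h
    have := h.closed_left.completeSpace_coe
    exact ⟨M, N, h.inv_left, h.inv_right, h.closed_right, h.isCompl,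
      ContinuousLinearMap.isUnit_iff_bijective.1 hu, hc.mono (sigmaStar_subset k _)⟩

omit [CompleteSpace X] in
theorem IsSpectralSet.exists_nhds {s : Set ℂ} (hs : IsSpectralSet T s) {z : ℂ} (hz : z ∈ s) :
    ∃ U ∈ 𝓝 z, U ∩ spectrum ℂ T ⊆ s := by
  obtain ⟨V, hV, hVs⟩ := isOpen_induced_iff.1 hs.2.isOpen
  have key : ∀ w (hw : w ∈ spectrum ℂ T), w ∈ V ↔ w ∈ s := fun w hw =>
    Set.ext_iff.1 hVs ⟨w, hw⟩
  exact ⟨V, hV.mem_nhds ((key z (hs.1 hz)).2 hz), fun w hw => (key w hw.2).1 hw.1⟩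

theorem exists_countable_isSpectralSet_iff :
    (∃ s : Set ℂ, IsSpectralSet T s ∧ s.Countable ∧ (0 : ℂ) ∉ spectrum ℂ T \ s) ↔
      HasCountableSpectrumNearZero T := by
  constructor
  · rintro ⟨s, hs, hc, h0⟩
    by_cases hz : (0 : ℂ) ∈ spectrum ℂ T
    · obtain ⟨U, hU, hUs⟩ := hs.exists_nhds (not_not.1 fun h => h0 ⟨hz, h⟩)
      exact ⟨U, hU, hc.mono hUs⟩
    · exact ⟨_, (spectrum.isClosed T).isOpen_compl.mem_nhds hz, by simp⟩
  · rintro ⟨U, hU, hc⟩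
    obtain ⟨r, R, hr, hrR, hRU, hann⟩ := exists_annulus (spectrum.isClosed (𝕜 := ℂ) T) hU hc
    -- As the annulus misses the spectrum, the open and the closed ball of radius `r` cut out the
    -- same part of it, which is therefore clopen.
    refine ⟨spectrum ℂ T ∩ Metric.ball 0 r, ⟨inter_subset_left, ?_⟩, hc.mono ?_, ?_⟩
    · rw [Subtype.preimage_coe_self_inter]
      refine ⟨?_, Metric.isOpen_ball.preimage continuous_subtype_val⟩
      have : ((↑) ⁻¹' Metric.ball (0 : ℂ) r : Set (spectrum ℂ T)) =
          (↑) ⁻¹' Metric.closedBall (0 : ℂ) r := by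
        ext ⟨z, hz⟩
        refine ⟨fun h => Metric.ball_subset_closedBall h, fun h => ?_⟩
        by_contra hb
        exact hann ⟨Metric.closedBall_subset_closedBall hrR.le h, hb⟩ hz
      rw [this]
      exact Metric.isClosed_closedBall.preimage continuous_subtype_val
    · rintro z ⟨hz, hzb⟩
      exact ⟨hRU (Metric.closedBall_subset_closedBall hrR.le (Metric.ball_subset_closedBall hzb)), hz⟩
    · rintro ⟨h1, h2⟩
      exact h2 ⟨h1, Metric.mem_ball_self hr⟩

theorem IsSpectralSet.countable_iff {s : Set ℂ} (hs : IsSpectralSet T s) :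
    s.Countable ↔ s \ {0} ⊆ ⋃ β : Ordinal.{0}, ⋃ _ : β < ω₁, iso (acc β (spectrum ℂ T)) := by
  have hcl := spectrum.isClosed (𝕜 := ℂ) T
  constructor
  · rintro hc z ⟨hz, -⟩
    obtain ⟨U, hU, hUs⟩ := hs.exists_nhds hz
    obtain ⟨b, hb, hzb⟩ := exists_mem_iso_acc (hs.1 hz)
      ((notMem_acc_omega_one_iff hcl).2 ⟨U, hU, hc.mono hUs⟩)
    exact mem_iUnion₂.2 ⟨b, hb, hzb⟩
  · intro h
    -- The point `0` is exempt from the hypothesis, but a single point does not affect countability.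
    refine ((countable_singleton 0).union (countable_diff_acc_omega_one hcl)).mono fun z hz => ?_
    by_cases hz0 : z = 0
    · exact Or.inl hz0
    · obtain ⟨b, hb, hzb⟩ := mem_iUnion₂.1 (h ⟨hz, hz0⟩)
      exact Or.inr (iso_acc_subset_diff hb hzb)

theorem HasCountableSpectrumNearZero.exists_generalized_inverse
    (h : HasCountableSpectrumNearZero T) :
    ∃ S ∈ comm2 T, S ^ 2 * T = S ∧ (spectrum ℂ (T * (1 - S * T))).Countable := by
  obtain ⟨p, s, hcomm, -, hs, hss, hc⟩ := exists_idempotent_of_countable_nhds h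
  exact ⟨s, mem_comm2_iff.2 fun R hR => (hcomm R hR).2, hss, by rwa [hs, sub_sub_cancel]⟩

theorem HasCountableSpectrumNearZero.exists_idempotent (h : HasCountableSpectrumNearZero T) :
    ∃ P ∈ comm2 T, IsIdempotentElem P ∧ IsAlmostInvertible (T + P) ∧
      (spectrum ℂ (T * P)).Countable := by
  obtain ⟨S, hS, hSS, hc⟩ := h.exists_generalized_inverse
  have hST : Commute S T := mem_comm_iff.1 (comm2_subset_comm hS)
  refine ⟨1 - S * T, mem_comm2_iff.2 fun R hR => (Commute.one_right R).sub_right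
    ((mem_comm2_iff.1 hS R hR).mul_right hR), (isIdempotentElem_of_generalized_inverse hST hSS).one_sub,
    isAlmostInvertible_iff.2 (countable_nhds_add_idempotent hST hSS hc), hc⟩

theorem hasCountableSpectrumNearZero_of_idempotent {k : SpectrumKind} {P : X →L[ℂ] X}
    (hPT : P ∈ comm T) (hP : IsIdempotentElem P) (h : IsAlmostInvertible (T + P))
    (hc : (sigmaStar k (T * P)).Countable) : HasCountableSpectrumNearZero T :=
  countable_nhds_of_add_idempotent hP (mem_comm_iff.1 hPT) (isAlmostInvertible_iff.1 h)
    ((countable_sigmaStar_iff k _).1 hc)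

omit [CompleteSpace X] in
theorem sub_sq_mul_eq {S : X →L[ℂ] X} (hS : S ∈ comm T) : T - T ^ 2 * S = T * (1 - S * T) := by
  rw [mul_sub, mul_one, (mem_comm_iff.1 hS).eq, sq, mul_assoc]

theorem hasCountableSpectrumNearZero_of_generalized_inverse {k : SpectrumKind} {S : X →L[ℂ] X}
    (hS : S ∈ comm T) (hSS : S ^ 2 * T = S) (hc : (sigmaStar k (T - T ^ 2 * S)).Countable) :
    HasCountableSpectrumNearZero T := by
  rw [sub_sq_mul_eq hS, countable_sigmaStar_iff] at hc
  exact countable_nhds_of_generalized_inverse (mem_comm_iff.1 hS) hSS hc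

end Characterizations

end AlmostInv

theorem mainTheorem3 {X : Type*} [NormedAddCommGroup X] [NormedSpace ℂ X] [CompleteSpace X]
    (k : AlmostInv.SpectrumKind) (T : X →L[ℂ] X) :
    List.TFAE [
      AlmostInv.IsAlmostInvertible T,
      AlmostInv.IsGInvertible k ω₁ T,
      (0 : ℂ) ∉ AlmostInv.acc ω₁ (AlmostInv.sigmaStar k T),
      ∃ M N : Submodule ℂ X, AlmostInv.IsRed2 T M N ∧ AlmostInv.IsAlmostInvPair T M N,
      ∃ (M N : Submodule ℂ X) (hM : ∀ x ∈ M, T x ∈ M) (hN : ∀ x ∈ N, T x ∈ N),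
        IsClosed (N : Set X) ∧ IsCompl M N ∧ Function.Bijective (T.restrict hM) ∧
          (AlmostInv.sigmaStar k (T.restrict hN)).Countable,
      ∃ s : Set ℂ, AlmostInv.IsSpectralSet T s ∧ s.Countable ∧ (0 : ℂ) ∉ spectrum ℂ T \ s,
      ∃ s : Set ℂ, AlmostInv.IsSpectralSet T s ∧ (0 : ℂ) ∉ spectrum ℂ T \ s ∧
        s \ {0} ⊆ ⋃ β : Ordinal.{0}, ⋃ _ : β < ω₁,
          AlmostInv.iso (AlmostInv.acc β (spectrum ℂ T)),
      ∃ P ∈ AlmostInv.comm T, IsIdempotentElem P ∧ AlmostInv.IsAlmostInvertible (T + P) ∧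
        (AlmostInv.sigmaStar k (T * P)).Countable,
      ∃ P ∈ AlmostInv.comm2 T, IsIdempotentElem P ∧ AlmostInv.IsAlmostInvertible (T + P) ∧
        (AlmostInv.sigmaStar k (T * P)).Countable,
      ∃ S ∈ AlmostInv.comm T, S ^ 2 * T = S ∧
        (AlmostInv.sigmaStar k (T - T ^ 2 * S)).Countable,
      ∃ S ∈ AlmostInv.comm2 T, S ^ 2 * T = S ∧
        (AlmostInv.sigmaStar k (T - T ^ 2 * S)).Countable] := by
  tfae_have 1 ↔ 2 := AlmostInv.isAlmostInvertible_iff.trans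
    (AlmostInv.isGInvertible_omega_one_iff k).symm
  tfae_have 1 ↔ 3 := AlmostInv.isAlmostInvertible_iff.trans
    (AlmostInv.notMem_acc_omega_one_sigmaStar_iff k).symm
  tfae_have 1 → 4 := fun h => (AlmostInv.isAlmostInvertible_iff.1 h).exists_isRed2
  tfae_have 4 → 1 := fun ⟨M, N, _, h⟩ => ⟨M, N, h⟩
  tfae_have 1 ↔ 5 := AlmostInv.isAlmostInvertible_iff.trans (AlmostInv.exists_isCompl_iff k).symm
  tfae_have 1 ↔ 6 := AlmostInv.isAlmostInvertible_iff.trans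
    AlmostInv.exists_countable_isSpectralSet_iff.symm
  tfae_have 6 → 7 := fun ⟨s, hs, hc, h0⟩ => ⟨s, hs, h0, hs.countable_iff.1 hc⟩
  tfae_have 7 → 6 := fun ⟨s, hs, h0, h⟩ => ⟨s, hs, hs.countable_iff.2 h, h0⟩
  tfae_have 1 → 9 := fun h => by
    obtain ⟨P, hP, hPP, ha, hc⟩ := (AlmostInv.isAlmostInvertible_iff.1 h).exists_idempotent
    exact ⟨P, hP, hPP, ha, (AlmostInv.countable_sigmaStar_iff k _).2 hc⟩
  tfae_have 9 → 8 := fun ⟨P, hP, h⟩ => ⟨P, AlmostInv.comm2_subset_comm hP, h⟩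
  tfae_have 8 → 1 := fun ⟨P, hP, hPP, ha, hc⟩ => AlmostInv.isAlmostInvertible_iff.2
    (AlmostInv.hasCountableSpectrumNearZero_of_idempotent hP hPP ha hc)
  tfae_have 1 → 11 := fun h => by
    obtain ⟨S, hS, hSS, hc⟩ := (AlmostInv.isAlmostInvertible_iff.1 h).exists_generalized_inverse
    refine ⟨S, hS, hSS, (AlmostInv.countable_sigmaStar_iff k _).2 ?_⟩
    rwa [AlmostInv.sub_sq_mul_eq (AlmostInv.comm2_subset_comm hS)]
  tfae_have 11 → 10 := fun ⟨S, hS, h⟩ => ⟨S, AlmostInv.comm2_subset_comm hS, h⟩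
  tfae_have 10 → 1 := fun ⟨S, hS, hSS, hc⟩ => AlmostInv.isAlmostInvertible_iff.2
    (AlmostInv.hasCountableSpectrumNearZero_of_generalized_inverse hS hSS hc)
  tfae_finish
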